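/- All graphs are finite and simple, and $\mathbb{N}=\{1,2,3,\dots\}$. A graph $H$ is a minor of a graph $G$ if $H$ is isomorphic to a graph that can be obtained from a subgraph of $G$ by contracting edges; $G$ is $K_t$-minor-free if the complete graph $K_t$ is not a minor of $G$. For sets $A,B\subseteq V(G)$, a flip between $A$ and $B$ inverts the adjacency between any two distinct vertices $a\in A$ and $b\in B$. For $k\in\mathbb{N}$, a $k$-flip of $G$ is a graph obtained from $G$ by a finite sequence of flips between pairs of (possibly equal) parts of some partition of $V(G)$ into at most $k$ parts. In the flip-width game with radius $r\in\mathbb{N}$ and width $k\in\mathbb{N}$ on $G$, initially $G_0=G$ and the runner chooses a vertex $x_0$ of $G$. In each round $i\ge 1$ the flipper announces a $k$-flip $G_i$ of $G$, and the runner, knowing $G_i$, moves from $x_{i-1}$ to a vertex $x_i$ along a path of length at most $r$ in the previous graph $G_{i-1}$. The flipper wins if at some point $x_i$ is an isolated vertex of $G_i$. The radius-$r$ flip-width $\mathrm{fw}_r(G)$ is the least $k\in\mathbb{N}$ such that the flipper has a winning strategy in the game with radius $r$ and width $k$ on $G$. **Theorem.** There is a function $g:\mathbb{N}\to\mathbb{R}$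 with $g(t)=o(t)$ as $t\to\infty$ such that for all $r,t\in\mathbb{N}$, every $K_t$-minor-free graph $G$ satisfies $$\mathrm{fw}_r(G)\le 3^{2t/3+g(t)}\,t^2\,r.$$ -/

import Mathlib

open Asymptotics

namespace FlipWidthGame

/-- `H` is a minor of `G`: there are pairwise disjoint sets of vertices of `G` (branch sets), one
for each vertex of `H`, each inducing a connected (in particular nonempty) subgraph of `G`, such
that adjacent vertices of `H` have branch sets joined by an edge of `G`. Contracting the branch
sets and deleting whatever is not needed yields `H`. -/
def IsMinor {W V : Type*} (H : SimpleGraph W) (G : SimpleGraph V) : Prop :=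
  ∃ B : W → Set V,
    (∀ w, (G.induce (B w)).Connected) ∧
    (∀ w w', w ≠ w' → Disjoint (B w) (B w')) ∧
    (∀ w w', H.Adj w w' → ∃ a ∈ B w, ∃ b ∈ B w', G.Adj a b)

/-- `G` is `K_t`-minor-free. -/
def CompleteMinorFree {V : Type*} (t : ℕ) (G : SimpleGraph V) : Prop :=
  ¬ IsMinor (SimpleGraph.completeGraph (Fin t)) G

/-- The graph obtained from `G` by a flip between `A` and `B`: the adjacency of every pair of
distinct vertices `a ∈ A`, `b ∈ B` is inverted. -/
def flip {V : Type*} (G : SimpleGraph V) (A B : Set V) : SimpleGraph V where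
  Adj a b := a ≠ b ∧ Xor (G.Adj a b) ((a ∈ A ∧ b ∈ B) ∨ (a ∈ B ∧ b ∈ A))
  symm := ⟨fun a b h => by
    refine ⟨h.1.symm, ?_⟩
    have h2 := h.2
    unfold Xor at h2 ⊢
    rw [G.adj_comm b a]
    tauto⟩
  loopless := ⟨fun _ h => h.1 rfl⟩

/-- `G'` is obtained from `G` by a finite sequence of flips between members of `P`. -/
inductive IsFlipSeq {V : Type*} (P : Set (Set V)) (G : SimpleGraph V) : SimpleGraph V → Prop
  | refl : IsFlipSeq P G G
  | step {G' : SimpleGraph V} {A B : Set V} (h : IsFlipSeq P G G') (hA : A ∈ P) (hB : B ∈ P) :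
      IsFlipSeq P G (flip G' A B)

/-- `G'` is a `k`-flip of `G`: a `P`-flip for some partition `P` of the vertex set into at most
`k` (nonempty) parts. -/
def IsKFlip {V : Type*} (k : ℕ) (G G' : SimpleGraph V) : Prop :=
  ∃ P : Set (Set V), Setoid.IsPartition P ∧ P.encard ≤ k ∧ IsFlipSeq P G G'

/-- A strategy of the flipper: the graph announced in round `i + 1`, given the positions
`x 0, …, x i` of the runner so far. -/
abbrev Strategy (V : Type*) : Type _ := (i : ℕ) → (Fin (i + 1) → V) → SimpleGraph V

/-- The graph `G_i` of round `i`, when the flipper follows `σ` and the runner's positions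
are `x 0, x 1, …`; initially it is `G`. -/
def graphAt {V : Type*} (G : SimpleGraph V) (σ : Strategy V) (x : ℕ → V) : ℕ → SimpleGraph V
  | 0 => G
  | i + 1 => σ i (fun j => x j)

/-- The runner's moves are legal: in round `i + 1` the runner moves from `x i` to `x (i + 1)`
along a path of length at most `r` in the previous graph `G_i`. -/
def IsLegalRun {V : Type*} (G : SimpleGraph V) (r : ℕ) (σ : Strategy V) (x : ℕ → V) : Prop :=
  ∀ i, ∃ p : (graphAt G σ x i).Walk (x i) (x (i + 1)), p.IsPath ∧ p.length ≤ r

/-- The flipper has a winning strategy in the flip-width game of radius `r` and width `k` on `G`: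
all graphs announced are `k`-flips of `G`, and against every run there is a round `i` such that
`x i` is isolated in `G_i`. -/
def FlipperWins {V : Type*} (G : SimpleGraph V) (r k : ℕ) : Prop :=
  ∃ σ : Strategy V, (∀ i h, IsKFlip k G (σ i h)) ∧
    ∀ x : ℕ → V, IsLegalRun G r σ x → ∃ i, (graphAt G σ x i).IsIsolated (x i)

/-- The radius-`r` flip-width of `G`: the least positive integer `k` such that the flipper wins
with width `k`. For a finite graph such a `k` exists, see `flipperWins_set_nonempty`. -/
noncomputable def flipWidth {V : Type*} (G : SimpleGraph V) (r : ℕ) : ℕ :=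
  sInf {k : ℕ | 1 ≤ k ∧ FlipperWins G r k}

theorem IsFlipSeq.head {V : Type*} {P : Set (Set V)} {G G' : SimpleGraph V} {A B : Set V}
    (hA : A ∈ P) (hB : B ∈ P) (h : IsFlipSeq P (flip G A B) G') : IsFlipSeq P G G' := by
  induction h with
  | refl => exact .step .refl hA hB
  | step _ hA' hB' ih => exact .step ih hA' hB'

theorem isFlipSeq_bot {V : Type*} [Finite V] (G : SimpleGraph V) :
    IsFlipSeq (Set.range fun v : V => ({v} : Set V)) G ⊥ := by
  induction G using WellFoundedLT.induction with
  | ind G ih =>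
    by_cases hG : G = ⊥
    · subst hG; exact .refl
    · obtain ⟨a, b, hab⟩ := SimpleGraph.ne_bot_iff_exists_adj.mp hG
      refine .head (A := {a}) (B := {b}) ⟨a, rfl⟩ ⟨b, rfl⟩ (ih _ ?_)
      refine lt_of_le_of_ne ?_ ?_
      · intro c d hcd
        rcases hcd.2 with h | ⟨h, h'⟩
        · exact h.1
        · exfalso
          rcases h with ⟨hc, hd⟩ | ⟨hc, hd⟩
          · rw [Set.mem_singleton_iff] at hc hd
            subst hc hd; exact h' hab
          · rw [Set.mem_singleton_iff] at hc hd
            subst hc hd; exact h' hab.symm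
      · intro h
        have h1 : (flip G {a} {b}).Adj a b := by rw [h]; exact hab
        rcases h1.2 with h2 | h2
        · exact h2.2 (Or.inl ⟨rfl, rfl⟩)
        · exact h2.2 hab

/-- The minimum defining `flipWidth` is over a nonempty set when the graph is finite. -/
theorem flipperWins_set_nonempty {V : Type*} [Finite V] (G : SimpleGraph V) (r : ℕ) :
    {k : ℕ | 1 ≤ k ∧ FlipperWins G r k}.Nonempty := by
  refine ⟨Nat.card V + 1, by omega, fun _ _ => ⊥, fun _ _ => ⟨Set.range fun v : V => {v}, ?_, ?_,
    isFlipSeq_bot G⟩, fun x _ => ⟨1, fun v h => h⟩⟩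
  · refine ⟨?_, fun a => ⟨{a}, ⟨⟨a, rfl⟩, rfl⟩, ?_⟩⟩
    · rintro ⟨v, hv⟩
      exact Set.singleton_ne_empty v hv
    · rintro _ ⟨⟨v, rfl⟩, hv⟩
      rw [Set.mem_singleton_iff.mp hv]
  · rw [← Set.image_univ]
    refine (Set.encard_image_le _ _).trans ?_
    rw [Set.encard_univ, ENat.card_eq_coe_natCard]
    exact_mod_cast Nat.le_succ _

end FlipWidthGame

/-! The flipper only ever isolates small vertex sets. The territory confining the runner is bordered
by pairwise adjacent connected sets, each also adjacent to the territory. Together with it they form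
a clique model, so there are fewer than `t` of them. Geodesics of the territory from a common root
towards each bordering set form a new connected set `H` that cuts the territory, and a geodesic has
only O(n) vertices within distance n of any point. Isolating `H` and the old border near the runner,
at most `t ^ 2 * (4 * r + 3)` vertices, confines the runner to a strictly smaller territory
(`IsTerritory.exists_separator`, `CompleteMinorFree.flipperWins`).

Isolating `A` is a flip for the partition into singletons of `A` and classes of outer vertices with
equal neighbourhoods in `A`. The number of these classes is at most twice the number of cliques of
some minor on `A` (`exists_isMinor_ncard_traces_le`), so it remains to count cliques in a
K_t-minor-free graph. Deleting vertices of small degree localizes the count to sets of size at most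
3t^2. Branching on vertices with many non-neighbours then reduces, at a cost of 3^(o(t)), to nearly
complete graphs. There, adjacent pairs without common non-neighbours are branch sets that, beside
the singletons of a clique of size a, force n + a ≤ 2t + o(t). A graph with n vertices and clique
number a has at most 3^((n+a)/3) cliques, which gives 3^(2t/3 + o(t)). -/

open Asymptotics

namespace FlipWidthGame

open SimpleGraph

/-! ### Minors and clique models -/

section Minors

theorem connected_induce_biUnion {V W : Type*} {G : SimpleGraph V} {H : SimpleGraph W}
    {S : Set W} {C : W → Set V} (hS : (H.induce S).Connected)
    (hC : ∀ a ∈ S, (G.induce (C a)).Connected)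
    (hadj : ∀ a ∈ S, ∀ b ∈ S, H.Adj a b → ∃ x ∈ C a, ∃ y ∈ C b, G.Adj x y) :
    (G.induce (⋃ a ∈ S, C a)).Connected := by
  have key : ∀ (a b : S), (H.induce S).Walk a b →
      ∃ s ⊆ (⋃ a ∈ S, C a), (G.induce s).Connected ∧ C a ⊆ s ∧ C b ⊆ s := by
    intro a b p
    induction p with
    | nil => exact ⟨_, Set.subset_biUnion_of_mem (Subtype.prop _), hC _ (Subtype.prop _),
        subset_rfl, subset_rfl⟩
    | @cons u v w h p ih =>
      obtain ⟨s, hs, hconn, h1, h2⟩ := ih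
      obtain ⟨x, hx, y, hy, hxy⟩ := hadj u u.2 v v.2 h
      exact ⟨C u ∪ s, Set.union_subset (Set.subset_biUnion_of_mem u.2) hs,
        connected_induce_union (hC _ u.2).preconnected hconn.preconnected hx (h1 hy) hxy,
        Set.subset_union_left, h2.trans Set.subset_union_right⟩
  obtain ⟨a⟩ := hS.nonempty
  obtain ⟨u, hu⟩ := (hC a a.2).nonempty
  refine induce_connected_of_patches u (Set.mem_biUnion a.2 hu) fun {v} hv => ?_
  obtain ⟨b, hb, hvb⟩ := Set.mem_iUnion₂.1 hv
  obtain ⟨p⟩ := hS.preconnected a ⟨b, hb⟩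
  obtain ⟨s, hs, hconn, h1, h2⟩ := key _ _ p
  exact ⟨s, hs, h1 hu, h2 hvb, hconn.preconnected _ _⟩

theorem IsMinor.trans {U W V : Type*} {F : SimpleGraph U} {H : SimpleGraph W}
    {G : SimpleGraph V} (h₁ : IsMinor F H) (h₂ : IsMinor H G) : IsMinor F G := by
  obtain ⟨B, hBc, hBd, hBa⟩ := h₁
  obtain ⟨C, hCc, hCd, hCa⟩ := h₂
  refine ⟨fun u => ⋃ a ∈ B u, C a, fun u => ?_, fun u u' huu => ?_, fun u u' huu => ?_⟩
  · exact connected_induce_biUnion (hBc u) (fun a _ => hCc a) fun a _ b _ hab => hCa a b hab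
  · rw [Set.disjoint_left]
    intro x hx hx'
    obtain ⟨a, ha, hxa⟩ := Set.mem_iUnion₂.1 hx
    obtain ⟨b, hb, hxb⟩ := Set.mem_iUnion₂.1 hx'
    have hab : a ≠ b := by
      rintro rfl
      exact Set.disjoint_left.1 (hBd u u' huu) ha hb
    exact Set.disjoint_left.1 (hCd a b hab) hxa hxb
  · obtain ⟨a, ha, b, hb, hab⟩ := hBa u u' huu
    obtain ⟨x, hx, y, hy, hxy⟩ := hCa a b hab
    exact ⟨x, Set.mem_biUnion ha hx, y, Set.mem_biUnion hb hy, hxy⟩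

theorem connected_induce_singleton {V : Type*} (G : SimpleGraph V) (v : V) :
    (G.induce {v}).Connected :=
  connected_iff_exists_forall_reachable _ |>.2 ⟨⟨v, rfl⟩, fun w => by
    rw [Subsingleton.elim w ⟨v, rfl⟩]⟩

theorem isMinor_induce {V : Type*} (G : SimpleGraph V) (S : Set V) : IsMinor (G.induce S) G :=
  ⟨fun v => {v.1}, fun v => connected_induce_singleton G _,
    fun v w hvw => by simpa [Subtype.ext_iff] using hvw,
    fun v w hvw => ⟨v, rfl, w, rfl, hvw⟩⟩

theorem CompleteMinorFree.of_isMinor {V W : Type*} {G : SimpleGraph V} {H : SimpleGraph W} {t : ℕ}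
    (hG : CompleteMinorFree t G) (h : IsMinor H G) : CompleteMinorFree t H :=
  fun h' => hG (h'.trans h)

/-- A family of branch sets of a complete minor. -/
def IsCliqueModel {V : Type*} (G : SimpleGraph V) (P : Set (Set V)) : Prop :=
  (∀ B ∈ P, (G.induce B).Connected) ∧
    P.Pairwise fun B B' => Disjoint B B' ∧ ∃ a ∈ B, ∃ b ∈ B', G.Adj a b

theorem CompleteMinorFree.ncard_lt {V : Type*} [Finite V] {G : SimpleGraph V} {t : ℕ}
    (hG : CompleteMinorFree t G) {P : Set (Set V)} (hP : IsCliqueModel G P) : P.ncard < t := by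
  by_contra! hcard
  refine hG ?_
  have : Fintype P := Fintype.ofFinite _
  have hle : Fintype.card (Fin t) ≤ Fintype.card P := by
    rwa [Fintype.card_fin, ← Nat.card_eq_fintype_card, Nat.card_coe_set_eq]
  obtain ⟨f⟩ := Function.Embedding.nonempty_of_card_le hle
  have hne : ∀ i j, i ≠ j → (f i : Set V) ≠ f j := fun i j hij h =>
    hij (f.injective (Subtype.ext h))
  exact ⟨fun i => f i, fun i => hP.1 _ (f i).2,
    fun i j hij => (hP.2 (f i).2 (f j).2 (hne i j hij)).1,
    fun i j hij => (hP.2 (f i).2 (f j).2 (hne i j hij.ne)).2⟩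

theorem IsCliqueModel.mono {V : Type*} {G : SimpleGraph V} {P Q : Set (Set V)}
    (hP : IsCliqueModel G P) (h : Q ⊆ P) : IsCliqueModel G Q :=
  ⟨fun B hB => hP.1 B (h hB), hP.2.mono h⟩

theorem IsCliqueModel.insert {V : Type*} {G : SimpleGraph V} {P : Set (Set V)} {B : Set V}
    (hP : IsCliqueModel G P) (hB : (G.induce B).Connected)
    (h : ∀ C ∈ P, Disjoint B C ∧ ∃ a ∈ B, ∃ b ∈ C, G.Adj a b) :
    IsCliqueModel G (insert B P) := by
  refine ⟨?_, ?_⟩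
  · rintro C (rfl | hC)
    exacts [hB, hP.1 C hC]
  · refine hP.2.insert fun C hC _ => ⟨h C hC, (h C hC).1.symm, ?_⟩
    obtain ⟨a, ha, b, hb, hab⟩ := (h C hC).2
    exact ⟨b, hb, a, ha, hab.symm⟩

end Minors

/-! ### Geodesics from a root -/

section Geodesics

/-- The level is the distance from `r` inside `T`, and `Q` is a shortest path from `r` to `v`.
Injectivity of the level on `Q` is all that is used later of its being a geodesic. -/
theorem exists_level_function {V : Type*} {G : SimpleGraph V} {T : Set V}
    (hT : (G.induce T).Connected) {r : V} (hr : r ∈ T) :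
    ∃ l : V → ℕ, (∀ x ∈ T, ∀ y ∈ T, G.Adj x y → l y ≤ l x + 1) ∧
      ∀ v ∈ T, ∃ Q ⊆ T, r ∈ Q ∧ v ∈ Q ∧ (G.induce Q).Connected ∧ Set.InjOn l Q := by
  classical
  refine ⟨fun v => if h : v ∈ T then (G.induce T).dist ⟨r, hr⟩ ⟨v, h⟩ else 0, ?_, ?_⟩
  · intro x hx y hy hxy
    have hadj : (G.induce T).Adj ⟨x, hx⟩ ⟨y, hy⟩ := hxy
    simp only [hx, hy, dite_true]
    have := hT.dist_triangle (u := ⟨r, hr⟩) (v := ⟨x, hx⟩) (w := ⟨y, hy⟩)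
    rw [dist_eq_one_iff_adj.2 hadj] at this
    exact this
  · set l : V → ℕ := fun v => if h : v ∈ T then (G.induce T).dist ⟨r, hr⟩ ⟨v, h⟩ else 0 with hl
    have hlv : ∀ v (hv : v ∈ T), l v = (G.induce T).dist ⟨r, hr⟩ ⟨v, hv⟩ := by
      intro v hv; simp [hl, hv]
    -- The bound on the levels in `Q` ensures that the vertex appended next lies on a new level.
    have key : ∀ n, ∀ v ∈ T, l v = n → ∃ Q ⊆ T, r ∈ Q ∧ v ∈ Q ∧ (G.induce Q).Connected ∧
        Set.InjOn l Q ∧ ∀ w ∈ Q, l w ≤ n := by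
      intro n
      induction n with
      | zero =>
        intro v hv h0
        rw [hlv v hv, hT.dist_eq_zero_iff] at h0
        have : r = v := congrArg Subtype.val h0
        subst this
        refine ⟨{r}, by simpa using hr, rfl, rfl, connected_induce_singleton G r, by simp, ?_⟩
        rintro w rfl
        rw [hlv w hr]; simp
      | succ n ih =>
        intro v hv hn
        obtain ⟨p, hp⟩ := hT.exists_walk_length_eq_dist ⟨v, hv⟩ ⟨r, hr⟩
        rw [dist_comm, ← hlv v hv, hn] at hp
        cases p with
        | nil => simp at hp
        | @cons _ u _ h p =>
          have hadj : G.Adj v u := h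
          have hu : l u = n := by
            have h1 : l u ≤ n := by
              rw [hlv u u.2, dist_comm]
              change (G.induce T).dist u ⟨r, hr⟩ ≤ n
              have := dist_le p
              simp only [Walk.length_cons] at hp
              omega
            have h2 := hT.dist_triangle (u := ⟨r, hr⟩) (v := u) (w := ⟨v, hv⟩)
            rw [dist_eq_one_iff_adj.2 h.symm, ← hlv u u.2, ← hlv v hv] at h2
            omega
          obtain ⟨Q, hQT, hrQ, huQ, hQc, hQi, hQn⟩ := ih u u.2 hu
          refine ⟨insert v Q, Set.insert_subset hv hQT, Or.inr hrQ, Or.inl rfl, ?_, ?_, ?_⟩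
          · rw [← Set.singleton_union]
            exact connected_induce_union (connected_induce_singleton G v).preconnected
              hQc.preconnected rfl huQ hadj
          · have hvQ : v ∉ Q := fun hvQ => by have := hQn v hvQ; omega
            rw [Set.injOn_insert hvQ]
            refine ⟨hQi, ?_⟩
            rintro ⟨w, hw, hwv⟩
            have := hQn w hw
            omega
          · rintro w (rfl | hw)
            · exact hn.le
            · exact (hQn w hw).trans (Nat.le_succ n)
    intro v hv
    obtain ⟨Q, h1, h2, h3, h4, h5, -⟩ := key _ v hv rfl
    exact ⟨Q, h1, h2, h3, h4, h5⟩

end Geodesics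

/-! ### Territories and their separators -/

section Territories

/-- `z` is joined to `x` by a walk of length at most `n` inside `T`. -/
def InBall {V : Type*} (G : SimpleGraph V) (T : Set V) (n : ℕ) (x z : V) : Prop :=
  ∃ p : G.Walk x z, p.length ≤ n ∧ ∀ w ∈ p.support, w ∈ T

/-- The vertices reached from `x` by walking at most `n` steps inside `T`, followed by at most
one arbitrary step. -/
def reach {V : Type*} (G : SimpleGraph V) (T : Set V) (n : ℕ) (x : V) : Set V :=
  {y | ∃ z, InBall G T n x z ∧ (z = y ∨ G.Adj z y)}

/-- The vertex set of the component of `G[S]` containing `x`. -/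
def componentIn {V : Type*} (G : SimpleGraph V) (S : Set V) (x : V) : Set V :=
  {y | ∃ n, InBall G S n x y}

variable {V : Type*} {G : SimpleGraph V}

theorem InBall.mono {S T : Set V} (h : S ⊆ T) {n m : ℕ} (hnm : n ≤ m) {x z : V}
    (hz : InBall G S n x z) : InBall G T m x z := by
  obtain ⟨p, hp, hpS⟩ := hz
  exact ⟨p, hp.trans hnm, fun w hw => h (hpS w hw)⟩

theorem InBall.refl {T : Set V} {x : V} (hx : x ∈ T) (n : ℕ) : InBall G T n x x :=
  ⟨.nil, Nat.zero_le _, by simpa using hx⟩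

theorem InBall.mem {T : Set V} {n : ℕ} {x z : V} (h : InBall G T n x z) : z ∈ T := by
  obtain ⟨p, -, hp⟩ := h
  exact hp z p.end_mem_support

theorem InBall.trans {T : Set V} {n m : ℕ} {x y z : V} (h : InBall G T n x y)
    (h' : InBall G T m y z) : InBall G T (n + m) x z := by
  obtain ⟨p, hp, hpT⟩ := h
  obtain ⟨q, hq, hqT⟩ := h'
  refine ⟨p.append q, by simpa using add_le_add hp hq, fun w hw => ?_⟩
  rcases (Walk.mem_support_append_iff p q).1 hw with h | h
  exacts [hpT w h, hqT w h]

theorem InBall.step {T : Set V} {n : ℕ} {x y z : V} (h : InBall G T n x y)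
    (hyz : G.Adj y z) (hz : z ∈ T) : InBall G T (n + 1) x z :=
  h.trans ⟨.cons hyz .nil, by simp, by simp [h.mem, hz]⟩

theorem reach_mono {S T : Set V} (h : S ⊆ T) (n : ℕ) (x : V) : reach G S n x ⊆ reach G T n x :=
  fun _ ⟨z, hz, hzy⟩ => ⟨z, hz.mono h le_rfl, hzy⟩

theorem componentIn_subset (S : Set V) (x : V) : componentIn G S x ⊆ S :=
  fun _ ⟨_, h⟩ => h.mem

theorem mem_componentIn_self {S : Set V} {x : V} (hx : x ∈ S) : x ∈ componentIn G S x :=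
  ⟨0, .refl hx 0⟩

theorem mem_componentIn_of_adj {S : Set V} {x y z : V} (h : y ∈ componentIn G S x)
    (hyz : G.Adj y z) (hz : z ∈ S) : z ∈ componentIn G S x := by
  obtain ⟨n, hn⟩ := h
  exact ⟨_, hn.step hyz hz⟩

theorem connected_componentIn {S : Set V} {x : V} (hx : x ∈ S) :
    (G.induce (componentIn G S x)).Connected := by
  classical
  refine induce_connected_of_patches x (mem_componentIn_self hx) fun {v} hv => ?_
  obtain ⟨n, p, -, hp⟩ := hv
  refine ⟨{w | w ∈ p.support}, fun w hw => ?_, p.start_mem_support, p.end_mem_support,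
    p.connected_induce_support.preconnected _ _⟩
  exact ⟨_, p.takeUntil w hw, le_rfl, fun u hu => hp u (p.support_takeUntil_subset_support hw hu)⟩

theorem level_le_of_inBall {l : V → ℕ} {T : Set V}
    (hl : ∀ x ∈ T, ∀ y ∈ T, G.Adj x y → l y ≤ l x + 1) {n : ℕ} {x z : V}
    (h : InBall G T n x z) : l z ≤ l x + n ∧ l x ≤ l z + n := by
  obtain ⟨p, hp, hpT⟩ := h
  induction p generalizing n with
  | nil => omega
  | @cons u v w h p ih =>
    simp only [Walk.length_cons] at hp
    have h1 := ih (n := n - 1) (by omega) fun w hw => hpT w (by simp [hw])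
    have hu := hpT u (by simp)
    have hv := hpT v (by simp)
    have h2 := hl u hu v hv h
    have h3 := hl v hv u hu h.symm
    omega

/-- Vertices of `reach G T n x` in `T` have level within `n + 1` of that of `x`, which leaves `2 *
(n + 1) + 1` levels, each used at most once by `Q`. -/
theorem ncard_inter_reach_le [Finite V] {l : V → ℕ} {T Q : Set V}
    (hl : ∀ x ∈ T, ∀ y ∈ T, G.Adj x y → l y ≤ l x + 1) (hQT : Q ⊆ T) (hQ : Set.InjOn l Q)
    (n : ℕ) (x : V) : (Q ∩ reach G T n x).ncard ≤ 2 * n + 3 := by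
  rw [← (hQ.mono Set.inter_subset_left).ncard_image]
  have hsub : l '' (Q ∩ reach G T n x) ⊆ Finset.Icc (l x - (n + 1)) (l x + (n + 1)) := by
    rintro _ ⟨y, ⟨hyQ, z, hz, hzy⟩, rfl⟩
    have h1 := level_le_of_inBall hl hz
    have h2 : l y ≤ l z + 1 ∧ l z ≤ l y + 1 := by
      rcases hzy with rfl | hzy
      · omega
      · exact ⟨hl z hz.mem y (hQT hyQ) hzy, hl y (hQT hyQ) z hz.mem hzy.symm⟩
    simp only [Finset.coe_Icc, Set.mem_Icc]
    omega
  refine (Set.ncard_le_ncard hsub (Finset.finite_toSet _)).trans ?_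
  rw [Set.ncard_coe_finset, Nat.card_Icc]
  omega

theorem ncard_sUnion_inter_le [Finite V] {P : Set (Set V)} {R : Set V} {k : ℕ}
    (h : ∀ B ∈ P, (B ∩ R).ncard ≤ k) : (⋃₀ P ∩ R).ncard ≤ P.ncard * k := by
  classical
  induction P, Set.toFinite P using Set.Finite.induction_on with
  | empty => simp
  | @insert B P hB _ ih =>
    rw [Set.ncard_insert_of_notMem hB (Set.toFinite _), Set.sUnion_insert,
      Set.union_inter_distrib_right]
    refine (Set.ncard_union_le _ _).trans ?_
    have h1 := ih fun C hC => h C (Or.inr hC)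
    have h2 := h B (Or.inl rfl)
    linarith

/-- `T` is connected, and its neighbourhood is covered by a family `P` of pairwise adjacent branch
sets, each of which has few vertices close to any given vertex of `T`. -/
structure IsTerritory (G : SimpleGraph V) (t : ℕ) (T : Set V) (P : Set (Set V)) : Prop where
  connected : (G.induce T).Connected
  model : IsCliqueModel G P
  disjoint_adj : ∀ B ∈ P, Disjoint T B ∧ ∃ a ∈ T, ∃ b ∈ B, G.Adj a b
  boundary : ∀ x ∈ T, ∀ y, G.Adj x y → y ∈ T ∨ y ∈ ⋃₀ P
  thin : ∀ B ∈ P, ∀ n, ∀ x, (B ∩ reach G T n x).ncard ≤ t * (2 * n + 3)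

/-- `T` itself serves as one more branch set beside those of `P`. -/
theorem IsTerritory.ncard_add_one_lt [Finite V] {t : ℕ} (hG : CompleteMinorFree t G) {T : Set V}
    {P : Set (Set V)} (h : IsTerritory G t T P) : P.ncard + 1 < t := by
  have hT : T ∉ P := fun hT => by
    have := (h.disjoint_adj T hT).1
    rw [disjoint_self] at this
    obtain ⟨x, hx⟩ := h.connected.nonempty
    rw [this] at hx
    exact hx
  rw [← Set.ncard_insert_of_notMem hT (Set.toFinite _)]
  exact hG.ncard_lt (h.model.insert h.connected h.disjoint_adj)

theorem isTerritory_componentIn_univ (t : ℕ) (x : V) :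
    IsTerritory G t (componentIn G Set.univ x) ∅ where
  connected := connected_componentIn trivial
  model := ⟨by simp, by simp⟩
  disjoint_adj := by simp
  boundary := fun _ hy _ hyz => Or.inl (mem_componentIn_of_adj hy hyz trivial)
  thin := by simp

/-- `H` is a union of at most `P.ncard + 1` geodesics of `T` through one root, chosen so that `H` is
adjacent to every member of `P`. For a component of `T \ H`, the new border consists of `H` and
those old branch sets that still touch the component. Thinness is inherited because `reach` is
monotone in the territory. -/
theorem IsTerritory.exists_separator [Finite V] {t : ℕ} (hG : CompleteMinorFree t G) {T : Set V}
    {P : Set (Set V)} (h : IsTerritory G t T P) :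
    ∃ H ⊆ T, H.Nonempty ∧
      (∀ n x, ((⋃₀ P ∪ H) ∩ reach G T n x).ncard ≤ t ^ 2 * (2 * n + 3)) ∧
      ∀ x ∈ T \ H, ∃ P', IsTerritory G t (componentIn G (T \ H) x) P' ∧
        ⋃₀ P' ⊆ ⋃₀ P ∪ H := by
  classical
  obtain ⟨r, hr⟩ := h.connected.nonempty
  obtain ⟨l, hl, hQ⟩ := exists_level_function h.connected hr
  have hex : ∀ B : Set V, ∃ Q ⊆ T, r ∈ Q ∧ (G.induce Q).Connected ∧ Set.InjOn l Q ∧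
      (B ∈ P → ∃ a ∈ Q, ∃ b ∈ B, G.Adj a b) := by
    intro B
    by_cases hB : B ∈ P
    · obtain ⟨-, a, ha, b, hb, hab⟩ := h.disjoint_adj B hB
      obtain ⟨Q, h1, h2, h3, h4, h5⟩ := hQ a ha
      exact ⟨Q, h1, h2, h4, h5, fun _ => ⟨a, h3, b, hb, hab⟩⟩
    · obtain ⟨Q, h1, h2, h3, h4, h5⟩ := hQ r hr
      exact ⟨Q, h1, h2, h4, h5, fun h => absurd h hB⟩
  choose Q hQT hrQ hQc hQi hQB using hex
  -- The extra index `∅` keeps the family nonempty, so that `H` contains the root even when `P` is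
  -- empty.
  set 𝒬 : Set (Set V) := Q '' insert ∅ P with h𝒬
  have h𝒬mem : ∀ C ∈ 𝒬, C ⊆ T ∧ r ∈ C ∧ (G.induce C).Connected ∧ Set.InjOn l C := by
    rintro _ ⟨B, -, rfl⟩
    exact ⟨hQT B, hrQ B, hQc B, hQi B⟩
  have hcardP := h.ncard_add_one_lt hG
  have h𝒬card : 𝒬.ncard ≤ P.ncard + 1 :=
    (Set.ncard_image_le (Set.toFinite _)).trans (Set.ncard_insert_le _ _)
  have h𝒬P : ∀ B ∈ P, ∃ a ∈ ⋃₀ 𝒬, ∃ b ∈ B, G.Adj a b := by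
    intro B hB
    obtain ⟨a, ha, b, hb, hab⟩ := hQB B hB
    exact ⟨a, ⟨_, ⟨B, Or.inr hB, rfl⟩, ha⟩, b, hb, hab⟩
  have h𝒬ne : 𝒬.Nonempty := ⟨_, ∅, Or.inl rfl, rfl⟩
  have hHT : ⋃₀ 𝒬 ⊆ T := Set.sUnion_subset fun C hC => (h𝒬mem C hC).1
  have hHc : (G.induce (⋃₀ 𝒬)).Connected :=
    induce_sUnion_connected_of_pairwise_not_disjoint h𝒬ne
      (fun {s t} hs ht => ⟨r, (h𝒬mem s hs).2.1, (h𝒬mem t ht).2.1⟩)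
      fun {s} hs => (h𝒬mem s hs).2.2.1
  have hHr : r ∈ ⋃₀ 𝒬 := by
    obtain ⟨C, hC⟩ := h𝒬ne
    exact ⟨C, hC, (h𝒬mem C hC).2.1⟩
  have hHthin : ∀ n x, (⋃₀ 𝒬 ∩ reach G T n x).ncard ≤ t * (2 * n + 3) := by
    intro n x
    refine (ncard_sUnion_inter_le (k := 2 * n + 3) fun C hC =>
      ncard_inter_reach_le hl (h𝒬mem C hC).1 (h𝒬mem C hC).2.2.2 n x).trans ?_
    exact Nat.mul_le_mul_right _ (by omega)
  generalize ⋃₀ 𝒬 = H at *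
  refine ⟨H, hHT, ⟨r, hHr⟩, fun n x => ?_, fun x hx => ?_⟩
  · rw [Set.union_inter_distrib_right]
    refine (Set.ncard_union_le _ _).trans ?_
    have h1 := ncard_sUnion_inter_le (P := P) (R := reach G T n x) fun B hB => h.thin B hB n x
    have h2 := hHthin n x
    have h3 : (P.ncard + 1) * (t * (2 * n + 3)) ≤ t * (t * (2 * n + 3)) :=
      Nat.mul_le_mul_right _ hcardP.le
    calc _ ≤ (P.ncard + 1) * (t * (2 * n + 3)) := by linarith
      _ ≤ _ := h3
      _ = _ := by ring
  · have hsub : componentIn G (T \ H) x ⊆ T \ H := componentIn_subset _ _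
    have hsubT : componentIn G (T \ H) x ⊆ T := hsub.trans Set.sdiff_subset
    have hcc : (G.induce (componentIn G (T \ H) x)).Connected := connected_componentIn hx
    have hdisj : Disjoint (componentIn G (T \ H) x) H :=
      Set.disjoint_of_subset_left hsub Set.disjoint_sdiff_left
    refine ⟨insert H {B ∈ P | ∃ a ∈ componentIn G (T \ H) x, ∃ b ∈ B, G.Adj a b}, ⟨hcc, ?_, ?_,
      ?_, ?_⟩, ?_⟩
    · refine (h.model.mono (Set.sep_subset _ _)).insert hHc fun B hB => ⟨?_, h𝒬P B hB.1⟩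
      exact Set.disjoint_of_subset_left hHT (h.disjoint_adj B hB.1).1
    · rintro B (rfl | hB)
      · refine ⟨hdisj, ?_⟩
        -- Without an edge to `H`, the component would be closed under adjacency in `T`, hence
        -- contain the root, which lies in `H`.
        by_contra! hcon
        have hcl : ∀ u v : T, (G.induce T).Walk u v → u.1 ∈ componentIn G (T \ B) x →
            v.1 ∈ componentIn G (T \ B) x := by
          intro u v p
          induction p with
          | nil => exact id
          | @cons u v w h p ih =>
            exact fun hu => ih (mem_componentIn_of_adj hu h ⟨v.2, fun hv => hcon u hu v hv h⟩)
        obtain ⟨p⟩ := h.connected.preconnected ⟨x, Set.sdiff_subset hx⟩ ⟨r, hr⟩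
        exact Set.disjoint_left.1 hdisj (hcl _ _ p (mem_componentIn_self hx)) hHr
      · exact ⟨Set.disjoint_of_subset_left hsubT (h.disjoint_adj B hB.1).1, hB.2⟩
    · intro y hy z hyz
      by_cases hzH : z ∈ H
      · exact Or.inr ⟨H, Or.inl rfl, hzH⟩
      rcases h.boundary y (hsubT hy) z hyz with hzT | ⟨B, hB, hzB⟩
      · exact Or.inl (mem_componentIn_of_adj hy hyz ⟨hzT, hzH⟩)
      · exact Or.inr ⟨B, Or.inr ⟨hB, y, hy, z, hzB, hyz⟩, hzB⟩
    · rintro B (rfl | hB) n y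
      · exact (Set.ncard_le_ncard (Set.inter_subset_inter_right _ (reach_mono hsubT n y))).trans
          (hHthin n y)
      · exact (Set.ncard_le_ncard (Set.inter_subset_inter_right _ (reach_mono hsubT n y))).trans
          (h.thin B hB.1 n y)
    · rw [Set.sUnion_insert, Set.union_comm]
      exact Set.union_subset_union_left _ (Set.sUnion_subset_sUnion (Set.sep_subset _ _))

/-- A complete-minor-free graph has a vertex of small degree. -/
theorem CompleteMinorFree.exists_ncard_neighborSet_le [Finite V] [Nonempty V] {t : ℕ}
    (hG : CompleteMinorFree t G) : ∃ v, (G.neighborSet v).ncard ≤ 3 * t ^ 2 := by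
  -- Territories shrink until `T` equals its separator. Every neighbour of a vertex of `T` then lies
  -- in the thin set, and radius 0 gives the bound `3 * t ^ 2`.
  have key : ∀ n, ∀ T P, T.ncard ≤ n → IsTerritory G t T P →
      ∃ v, (G.neighborSet v).ncard ≤ 3 * t ^ 2 := by
    intro n
    induction n with
    | zero =>
      intro T P hT h
      obtain ⟨x, hx⟩ := h.connected.nonempty
      rw [Nat.le_zero, Set.ncard_eq_zero (Set.toFinite _)] at hT
      rw [hT] at hx
      exact absurd hx (Set.notMem_empty x)
    | succ n ih =>
      intro T P hT h
      obtain ⟨H, hHT, hHne, hthin, hnext⟩ := h.exists_separator hG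
      by_cases hTH : T ⊆ H
      · obtain ⟨x, hx⟩ := hHne
        refine ⟨x, ?_⟩
        have := hthin 0 x
        have hsub : G.neighborSet x ⊆ (⋃₀ P ∪ H) ∩ reach G T 0 x := by
          refine fun y hy => ⟨?_, x, .refl (hHT hx) 0, Or.inr hy⟩
          rcases h.boundary x (hHT hx) y hy with h | h
          exacts [Or.inr (hTH h), Or.inl h]
        exact (Set.ncard_le_ncard hsub).trans (this.trans (by linarith))
      · obtain ⟨x, hxT, hxH⟩ := Set.not_subset.1 hTH
        obtain ⟨P', hP', -⟩ := hnext x ⟨hxT, hxH⟩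
        refine ih _ P' ?_ hP'
        have : (componentIn G (T \ H) x).ncard < T.ncard := by
          refine Set.ncard_lt_ncard ⟨(componentIn_subset _ _).trans Set.sdiff_subset, fun hsub => ?_⟩
          obtain ⟨y, hy⟩ := hHne
          exact (componentIn_subset _ _ (hsub (hHT hy))).2 hy
        omega
  obtain ⟨x⟩ := ‹Nonempty V›
  exact key _ _ _ le_rfl (isTerritory_componentIn_univ t x)

end Territories

/-! ### The strategy of the flipper -/

section Game

/-- The graph obtained from `G` by deleting all edges that meet `A`. -/
def isolate {V : Type*} (G : SimpleGraph V) (A : Set V) : SimpleGraph V where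
  Adj u v := G.Adj u v ∧ u ∉ A ∧ v ∉ A
  symm := ⟨fun _ _ h => ⟨h.1.symm, h.2.2, h.2.1⟩⟩
  loopless := ⟨fun v h => G.loopless.irrefl v h.1⟩

/-- The states of a play in which state `i + 1` depends on state `i` and the new position. -/
def stateSeq {S V : Type*} (init : V → S) (next : S → V → S) (x : ℕ → V) : ℕ → S
  | 0 => init (x 0)
  | i + 1 => next (stateSeq init next x i) (x (i + 1))

theorem stateSeq_congr {S V : Type*} (init : V → S) (next : S → V → S) {x y : ℕ → V} {i : ℕ}
    (h : ∀ j ≤ i, x j = y j) : stateSeq init next x i = stateSeq init next y i := by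
  induction i with
  | zero => simp [stateSeq, h 0 le_rfl]
  | succ i ih => simp [stateSeq, h (i + 1) le_rfl, ih fun j hj => h j (hj.trans (Nat.le_succ i))]

/-- The strategy of the flipper that isolates, in each round, a set depending on the current state
and the current position of the runner. -/
def stateStrategy {S V : Type*} (G : SimpleGraph V) (init : V → S) (next : S → V → S)
    (guard : S → V → Set V) : Strategy V := fun i h =>
  -- The index `min j i` prolongs the finite history to an infinite sequence; the state at `i` does
  -- not see the entries after `i`.
  isolate G (guard (stateSeq init next (fun j => h ⟨min j i, by omega⟩) i) (h (Fin.last i)))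

theorem graphAt_stateStrategy {S V : Type*} (G : SimpleGraph V) (init : V → S) (next : S → V → S)
    (guard : S → V → Set V) (x : ℕ → V) (i : ℕ) :
    graphAt G (stateStrategy G init next guard) x (i + 1) =
      isolate G (guard (stateSeq init next x i) (x i)) := by
  simp only [graphAt, stateStrategy, Fin.val_last]
  rw [stateSeq_congr init next (y := x)]
  intro j hj
  simp [hj]

/-- The state is a territory containing the runner. The guard is announced around `x i`, but
constrains the runner only after the move to `x (i + 1)`, made in the previous graph. Two moves of
length `r` are therefore covered by radius `2 * r`, and the last step of `reach` catches the border
vertex that the runner would step on. -/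
theorem CompleteMinorFree.flipperWins {V : Type*} [Finite V] {G : SimpleGraph V} {t : ℕ}
    (hG : CompleteMinorFree t G) {r k : ℕ}
    (hk : ∀ A : Set V, A.ncard ≤ t ^ 2 * (4 * r + 3) → IsKFlip k G (isolate G A)) :
    FlipperWins G r k := by
  classical
  let S := {p : Set V × Set (Set V) // IsTerritory G t p.1 p.2}
  have hex := fun s : S => s.2.exists_separator hG
  choose H hHT hHne hthin hnext using hex
  choose P' hP' hP'sub using hnext
  let init : V → S := fun x => ⟨(componentIn G Set.univ x, ∅), isTerritory_componentIn_univ t x⟩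
  let next : S → V → S := fun s x =>
    if hx : x ∈ s.1.1 \ H s then
      ⟨(componentIn G (s.1.1 \ H s) x, P' s x hx), hP' s x hx⟩ else s
  let guard : S → V → Set V := fun s x => (⋃₀ s.1.2 ∪ H s) ∩ reach G s.1.1 (2 * r) x
  refine ⟨stateStrategy G init next guard, fun i h => hk _ ?_, fun x hx => ?_⟩
  · refine (hthin _ (2 * r) _).trans (le_of_eq ?_)
    ring
  by_contra! hwin
  set s := stateSeq init next x with hs
  set Γ := graphAt G (stateStrategy G init next guard) x with hΓ
  have hΓs : ∀ i, Γ (i + 1) = isolate G (guard (s i) (x i)) :=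
    fun i => graphAt_stateStrategy G init next guard x i
  have hnotmem : ∀ i, x (i + 1) ∉ guard (s i) (x i) := by
    intro i hi
    apply hwin (i + 1)
    rw [hΓs]
    exact fun v hv => hv.2.1 hi
  -- The runner is in the current territory, cannot leave it by the next move, and each round has
  -- cost the territory a vertex. The last clause is absurd for large `i`.
  have inv : ∀ i, x i ∈ (s i).1.1 ∧ (∀ z (p : (Γ i).Walk (x i) z), p.length ≤ r →
      InBall G (s i).1.1 r (x i) z) ∧ (s i).1.1.ncard + i ≤ (s 0).1.1.ncard := by
    intro i
    induction i with
    | zero =>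
      refine ⟨mem_componentIn_self trivial, fun z p hp => ⟨p, hp, fun w hw => ?_⟩, le_rfl⟩
      exact ⟨_, Walk.takeUntil p w hw, le_rfl, fun _ _ => trivial⟩
    | succ i ih =>
      obtain ⟨hxi, hball, hcard⟩ := ih
      obtain ⟨p, -, hp⟩ := hx i
      have hb := hball _ p hp
      have hxH : x (i + 1) ∈ (s i).1.1 \ H (s i) := by
        refine ⟨hb.mem, fun hH => hnotmem i ⟨Or.inr hH, ?_⟩⟩
        exact ⟨_, hb.mono subset_rfl (by omega), Or.inl rfl⟩
      have hsi : (s (i + 1)).1 = (componentIn G ((s i).1.1 \ H (s i)) (x (i + 1)),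
          P' (s i) _ hxH) := by
        change (next (s i) (x (i + 1))).1 = _
        simp only [next]
        rw [dif_pos hxH]
      have hsub : (s (i + 1)).1.1 ⊆ (s i).1.1 \ H (s i) := by
        rw [hsi]; exact componentIn_subset _ _
      have hmem : x (i + 1) ∈ (s (i + 1)).1.1 := by
        rw [hsi]; exact mem_componentIn_self hxH
      refine ⟨hmem, ?_, ?_⟩
      · have hwalk : ∀ u z (q : (Γ (i + 1)).Walk u z) (m : ℕ), q.length + m ≤ r →
            InBall G (s (i + 1)).1.1 m (x (i + 1)) u →
              InBall G (s (i + 1)).1.1 (q.length + m) (x (i + 1)) z := by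
          intro u z q
          induction q with
          | nil => exact fun m _ hu => by simpa using hu
          | @cons u v w h q ihq =>
            intro m hm hu
            simp only [Walk.length_cons] at hm ⊢
            rw [hΓs] at h
            have hv : v ∈ (s (i + 1)).1.1 := by
              rcases (s (i + 1)).2.boundary u hu.mem v h.1 with hv | hv
              · exact hv
              refine absurd ⟨?_, u, ?_, Or.inr h.1⟩ h.2.2
              · rw [hsi] at hv
                exact hP'sub _ _ hxH hv
              · exact (hb.trans (hu.mono (hsub.trans Set.sdiff_subset) le_rfl)).mono subset_rfl
                  (by omega)
            have := ihq (m + 1) (by omega) (hu.step h.1 hv)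
            rwa [show q.length + 1 + m = q.length + (m + 1) by ring]
        exact fun z q hq => (hwalk _ z q 0 hq (.refl hmem 0)).mono subset_rfl hq
      · have : (s (i + 1)).1.1.ncard < (s i).1.1.ncard := by
          refine Set.ncard_lt_ncard ⟨hsub.trans Set.sdiff_subset, fun h => ?_⟩
          obtain ⟨y, hy⟩ := hHne (s i)
          exact (hsub (h (hHT _ hy))).2 hy
        omega
  have := (inv ((s 0).1.1.ncard + 1)).2.2
  omega

end Game

/-! ### Isolating a set by flips -/

section Flips

/-- A graph in which the edges at `A` are deleted is obtained by flips, if the adjacency to each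
vertex of `A` is constant on each part. -/
theorem isFlipSeq_isolate {V : Type*} [Finite V] (s : Setoid V) (A : Set V)
    (hA : ∀ a ∈ A, ∀ b, s a b → a = b) (G : SimpleGraph V)
    (hG : ∀ a ∈ A, ∀ b c, s b c → G.Adj a b → G.Adj a c) :
    IsFlipSeq s.classes G (isolate G A) := by
  induction G using WellFoundedLT.induction with
  | ind G ih =>
    by_cases h : ∃ a ∈ A, ∃ b, G.Adj a b
    · obtain ⟨a, ha, b, hab⟩ := h
      -- The class of `a` is `{a}`, and `a` is adjacent to the whole class of `b`. Flipping the two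
      -- classes thus only removes edges, all of them at `a`.
      set X : Set V := {x | s x a} with hX
      set Y : Set V := {x | s x b} with hY
      have hXa : ∀ x, x ∈ X ↔ x = a := fun x =>
        ⟨fun h => (hA a ha x (s.symm h)).symm, fun h => h ▸ s.refl a⟩
      have hY' : ∀ y ∈ Y, G.Adj a y := fun y hy => hG a ha b y (s.symm hy) hab
      have hadj : ∀ u v, (flip G X Y).Adj u v ↔
          G.Adj u v ∧ ¬ ((u = a ∧ v ∈ Y) ∨ (u ∈ Y ∧ v = a)) := by
        intro u v
        change u ≠ v ∧ Xor _ _ ↔ _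
        rw [hXa, hXa]
        constructor
        · rintro ⟨-, h | ⟨⟨rfl, h⟩ | ⟨h, rfl⟩, h'⟩⟩
          · exact h
          · exact absurd (hY' _ h) h'
          · exact absurd (hY' _ h).symm h'
        · rintro ⟨h, h'⟩
          exact ⟨h.ne, Or.inl ⟨h, h'⟩⟩
      have hiso : isolate (flip G X Y) A = isolate G A := by
        ext u v
        change (flip G X Y).Adj u v ∧ _ ↔ G.Adj u v ∧ _
        rw [hadj]
        refine ⟨fun h => ⟨h.1.1, h.2⟩, fun h => ⟨⟨h.1, ?_⟩, h.2⟩⟩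
        rintro (⟨rfl, -⟩ | ⟨-, rfl⟩)
        exacts [h.2.1 ha, h.2.2 ha]
      rw [← hiso]
      refine IsFlipSeq.head (A := X) (B := Y) ⟨a, rfl⟩ ⟨b, rfl⟩ (ih _ ?_ ?_)
      · refine lt_of_le_of_ne (fun u v h => ((hadj u v).1 h).1) fun h => ?_
        have hab' := hab
        rw [← h, hadj] at hab'
        exact hab'.2 (Or.inl ⟨rfl, s.refl b⟩)
      · intro c hc u v huv hcu
        rw [hadj] at hcu ⊢
        refine ⟨hG c hc u v huv hcu.1, fun h => hcu.2 ?_⟩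
        rcases h with ⟨rfl, hv⟩ | ⟨hcY, rfl⟩
        · exact Or.inl ⟨rfl, s.trans huv hv⟩
        · have := hA v ha u (s.symm huv)
          exact Or.inr ⟨hcY, this.symm⟩
    · have : isolate G A = G := by
        push Not at h
        ext u v
        exact ⟨fun h => h.1, fun hadj => ⟨hadj, fun hu => h u hu v hadj,
          fun hv => h v hv u hadj.symm⟩⟩
      rw [this]
      exact .refl

/-- The traces on `A` of the neighbourhoods of the vertices outside `A`. -/
def traces {V : Type*} (G : SimpleGraph V) (A : Set V) : Set (Set V) :=
  (fun v => G.neighborSet v ∩ A) '' Aᶜ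

/-- The parts are the singletons of `A` and the classes of outer vertices with equal trace;
adjacency to a vertex of `A` is constant on each. -/
theorem isKFlip_isolate {V : Type*} [Finite V] (G : SimpleGraph V) (A : Set V) {k : ℕ}
    (hk : A.ncard + (traces G A).ncard ≤ k) : IsKFlip k G (isolate G A) := by
  classical
  let c : V → V ⊕ Set V := fun v => if v ∈ A then Sum.inl v else Sum.inr (G.neighborSet v ∩ A)
  have hc : ∀ a ∈ A, ∀ b, c a = c b → a = b := by
    intro a ha b hab
    by_cases hb : b ∈ A
    · simpa [c, ha, hb] using hab
    · simp [c, ha, hb] at hab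
  refine ⟨(Setoid.ker c).classes, Setoid.isPartition_classes _, ?_,
    isFlipSeq_isolate (Setoid.ker c) A hc G ?_⟩
  · have hsub : (Setoid.ker c).classes ⊆
        (fun y => c ⁻¹' {y}) '' (Sum.inl '' A ∪ Sum.inr '' traces G A) := by
      rintro _ ⟨v, rfl⟩
      refine ⟨c v, ?_, rfl⟩
      by_cases hv : v ∈ A
      · exact Or.inl ⟨v, hv, by simp [c, hv]⟩
      · exact Or.inr ⟨_, ⟨v, hv, rfl⟩, by simp [c, hv]⟩
    have hfin : (Setoid.ker c).classes.Finite := Set.toFinite _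
    rw [← hfin.cast_ncard_eq]
    norm_cast
    refine (Set.ncard_le_ncard hsub (Set.toFinite _)).trans ?_
    refine (Set.ncard_image_le (Set.toFinite _)).trans ((Set.ncard_union_le _ _).trans ?_)
    exact (add_le_add (Set.ncard_image_le (Set.toFinite _))
      (Set.ncard_image_le (Set.toFinite _))).trans hk
  · intro a ha u v huv hau
    by_cases hu : u ∈ A
    · rwa [← hc u hu v huv]
    · by_cases hv : v ∈ A
      · rwa [hc v hv u huv.symm]
      · have : G.neighborSet u ∩ A = G.neighborSet v ∩ A := by
          have : c u = c v := huv
          simpa [c, hu, hv] using this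
        have h : a ∈ G.neighborSet u ∩ A := ⟨hau.symm, ha⟩
        rw [this] at h
        exact h.1.symm

end Flips

/-! ### Neighbourhood traces and cliques of a minor -/

section Traces

variable {V : Type*} {G : SimpleGraph V} {A : Set V}

/-- The graph on `A` in which each vertex `v` with `p v = some a` is contracted onto `a`. -/
def contraction (G : SimpleGraph V) (p : V → Option A) : SimpleGraph A where
  Adj a b := a ≠ b ∧ ∃ u v, p u = some a ∧ p v = some b ∧ G.Adj u v
  symm := ⟨fun _ _ ⟨h, u, v, hu, hv, huv⟩ => ⟨h.symm, v, u, hv, hu, huv.symm⟩⟩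
  loopless := ⟨fun _ h => h.1 rfl⟩

/-- Every vertex of `A` is mapped to itself, and every other vertex that is mapped somewhere is
adjacent to its image. -/
def IsStarMap (G : SimpleGraph V) (p : V → Option A) : Prop :=
  (∀ a : A, p a = some a) ∧ ∀ v ∉ A, ∀ a : A, p v = some a → G.Adj v a

theorem IsStarMap.isMinor_contraction {p : V → Option A} (hp : IsStarMap G p) :
    IsMinor (contraction G p) G := by
  refine ⟨fun a => {v | p v = some a}, fun a => ?_, fun a b hab => ?_, fun a b hab => ?_⟩
  · rw [connected_iff_exists_forall_reachable]
    refine ⟨⟨a, hp.1 a⟩, fun ⟨v, hv⟩ => ?_⟩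
    by_cases hvA : v ∈ A
    · have : v = a := by
        have h := hp.1 ⟨v, hvA⟩
        have hv' : p v = some a := hv
        rw [hv'] at h
        exact congrArg Subtype.val (Option.some_injective _ h).symm
      subst this
      exact .refl _
    · have : (G.induce {v | p v = some a}).Adj ⟨a, hp.1 a⟩ ⟨v, hv⟩ := (hp.2 v hvA a hv).symm
      exact this.reachable
  · rw [Set.disjoint_left]
    intro v hv hv'
    exact hab (Option.some_injective _ ((Eq.symm hv).trans hv'))
  · obtain ⟨-, u, v, hu, hv, huv⟩ := hab
    exact ⟨u, hu, v, hv, huv⟩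

/-- The number of distinct traces on `A` is at most twice the number of cliques of some minor of `G`
with vertex set `A`. -/
theorem exists_isMinor_ncard_traces_le [Finite V] (G : SimpleGraph V) (A : Set V) :
    ∃ K : SimpleGraph A, IsMinor K G ∧ (traces G A).ncard ≤
      2 * {s : Set A | K.IsClique s}.ncard := by
  classical
  -- `B` holds one representative per trace. A star map in `F` contracts the representatives in `D
  -- p` onto neighbours in `A`, and must create at least as many cliques as it contracts vertices.
  obtain ⟨B, hBA, hB⟩ := Set.exists_subset_bijOn Aᶜ (fun v => G.neighborSet v ∩ A)
  let D : (V → Option A) → Set V := fun p => {v | v ∉ A ∧ p v ≠ none}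
  let Q : (V → Option A) → Set (Set A) := fun p => {s | (contraction G p).IsClique s}
  let F : Set (V → Option A) := {p | IsStarMap G p ∧ D p ⊆ B ∧ (D p).ncard ≤ (Q p).ncard}
  have hne : F.Nonempty := by
    refine ⟨fun v => if h : v ∈ A then some ⟨v, h⟩ else none, ⟨fun a => by simp, ?_⟩, ?_, ?_⟩
    · intro v hv a h
      simp [hv] at h
    · intro v hv
      simp [D] at hv
    · have : D (fun v => if h : v ∈ A then some ⟨v, h⟩ else none) = ∅ := by
        ext v; simp [D]
      simp [this]
  obtain ⟨p, ⟨hp, hDB, hDQ⟩, hmax⟩ :=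
    Set.exists_max_image F (fun p => (D p).ncard) (Set.toFinite _) hne
  refine ⟨contraction G p, hp.isMinor_contraction, ?_⟩
  -- If the trace of `v` missed an edge `ab`, contracting `v` onto `a` would create the new clique
  -- `{a, b}`, against the maximality of `D p`. So the uncontracted representatives inject into the
  -- cliques as well.
  have hclique : ∀ v ∈ B \ D p, {a : A | G.Adj v a} ∈ Q p := by
    rintro v ⟨hvB, hvD⟩ a ha b hb hab
    by_contra hnadj
    have hvA : v ∉ A := hBA hvB
    have hpv : p v = none := by
      by_contra h
      exact hvD ⟨hvA, h⟩
    have hother : ∀ u c, p u = some c → u ≠ v := by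
      rintro u c hu rfl
      rw [hpv] at hu
      exact absurd hu (by simp)
    set q := Function.update p v (some a) with hq
    have hqu : ∀ u c, p u = some c → q u = some c := fun u c hu => by
      rw [hq, Function.update_of_ne (hother u c hu), hu]
    have hqv : q v = some a := Function.update_self ..
    have hle : contraction G p ≤ contraction G q := by
      rintro c d ⟨hcd, x, y, hx, hy, hxy⟩
      exact ⟨hcd, x, y, hqu x c hx, hqu y d hy, hxy⟩
    have hDq : D q = insert v (D p) := by
      ext u
      by_cases huv : u = v
      · subst huv; simp [D, hqv, hvA]
      · simp [D, hq, huv]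
    have hcard : (D q).ncard = (D p).ncard + 1 := by
      rw [hDq, Set.ncard_insert_of_notMem hvD (Set.toFinite _)]
    have hqP : q ∈ F := by
      refine ⟨⟨fun c => hqu _ _ (hp.1 c), fun u hu c huc => ?_⟩, ?_, ?_⟩
      · by_cases huv : u = v
        · subst huv
          rw [hqv] at huc
          rw [← Option.some_injective _ huc]
          exact ha
        · rw [hq, Function.update_of_ne huv] at huc
          exact hp.2 u hu c huc
      · rw [hDq]
        exact Set.insert_subset hvB hDB
      · rw [hcard]
        have : (Q p).ncard < (Q q).ncard := by
          refine Set.ncard_lt_ncard ⟨fun s hs => hs.mono hle, fun h => hnadj ?_⟩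
          have hmem : ({a, b} : Set A) ∈ Q q := by
            refine isClique_pair.2 fun hne => ⟨hne, v, b, hqv, hqu _ _ (hp.1 b), hb⟩
          exact (h hmem) (by simp) (by simp) hab
        omega
    have := hmax q hqP
    simp only [hcard] at this
    omega
  have hrest : (B \ D p).ncard ≤ (Q p).ncard := by
    refine Set.ncard_le_ncard_of_injOn (fun v => {a : A | G.Adj v a}) hclique ?_
    intro u hu v hv huv
    refine hB.injOn hu.1 hv.1 ?_
    ext x
    have := fun hx : x ∈ A => Set.ext_iff.1 huv ⟨x, hx⟩
    simp only [Set.mem_ofPred_eq] at this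
    simp only [Set.mem_inter_iff, mem_neighborSet]
    tauto
  have htr : traces G A = (fun v => G.neighborSet v ∩ A) '' B := hB.image_eq.symm
  rw [htr]
  refine (Set.ncard_image_le (Set.toFinite _)).trans ?_
  have := Set.ncard_le_ncard_sdiff_add_ncard B (D p)
  change _ ≤ 2 * (Q p).ncard
  omega

end Traces

/-! ### Counting cliques by branching -/

section CliqueCounts

open Classical in
/-- The number of cliques of `G` (including the empty one) contained in `S`. -/
noncomputable def cliqueCount {V : Type*} (G : SimpleGraph V) (S : Finset V) : ℕ :=
  (S.powerset.filter fun s : Finset V => G.IsClique (s : Set V)).card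

variable {V : Type*} {G : SimpleGraph V}

open Classical in
/-- The neighbours of `v` in `S`. -/
noncomputable def nbrs (G : SimpleGraph V) (S : Finset V) (v : V) : Finset V :=
  S.filter fun w => G.Adj v w

open Classical in
/-- The vertices of `S`, other than `v`, that are not adjacent to `v`. -/
noncomputable def nonnbrs (G : SimpleGraph V) (S : Finset V) (v : V) : Finset V :=
  S.filter fun w => w ≠ v ∧ ¬ G.Adj v w

theorem mem_nbrs {S : Finset V} {v w : V} : w ∈ nbrs G S v ↔ w ∈ S ∧ G.Adj v w := by
  simp [nbrs]

theorem mem_nonnbrs {S : Finset V} {v w : V} :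
    w ∈ nonnbrs G S v ↔ w ∈ S ∧ w ≠ v ∧ ¬ G.Adj v w := by
  simp [nonnbrs]

theorem nbrs_subset (S : Finset V) (v : V) : nbrs G S v ⊆ S := fun _ h => (mem_nbrs.1 h).1

theorem cliqueCount_empty : cliqueCount G ∅ = 1 := by
  classical
  simp [cliqueCount, Finset.filter_singleton]

theorem cliqueCount_mono {S T : Finset V} (h : S ⊆ T) : cliqueCount G S ≤ cliqueCount G T := by
  classical
  exact Finset.card_le_card (Finset.filter_subset_filter _ (Finset.powerset_mono.2 h))

open Classical in
theorem cliqueCount_le {S : Finset V} {v : V} :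
    cliqueCount G S ≤ cliqueCount G (S.erase v) + cliqueCount G (nbrs G S v) := by
  have hsub : (S.powerset.filter fun s : Finset V => G.IsClique (s : Set V)) ⊆
      ((S.erase v).powerset.filter fun s : Finset V => G.IsClique (s : Set V)) ∪
        ((nbrs G S v).powerset.filter fun s : Finset V => G.IsClique (s : Set V)).image (insert v) := by
    intro s hs
    simp only [Finset.mem_filter, Finset.mem_powerset, Finset.mem_union, Finset.mem_image] at hs ⊢
    by_cases hv : v ∈ s
    · refine Or.inr ⟨s.erase v, ⟨fun w hw => ?_, hs.2.subset (by simp)⟩, Finset.insert_erase hv⟩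
      have hw' := Finset.mem_erase.1 hw
      exact mem_nbrs.2 ⟨hs.1 hw'.2, hs.2 hv hw'.2 hw'.1.symm⟩
    · refine Or.inl ⟨fun w hw => Finset.mem_erase.2 ⟨?_, hs.1 hw⟩, hs.2⟩
      rintro rfl
      exact hv hw
  exact (Finset.card_le_card hsub).trans
    ((Finset.card_union_le _ _).trans (Nat.add_le_add_left Finset.card_image_le _))

open Classical in
theorem card_nbrs_add_card_nonnbrs {S : Finset V} {v : V} (hv : v ∈ S) :
    (nbrs G S v).card + (nonnbrs G S v).card + 1 = S.card := by
  have h1 : nbrs G S v ∪ nonnbrs G S v = S.erase v := by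
    ext w
    simp only [Finset.mem_union, mem_nbrs, mem_nonnbrs, Finset.mem_erase]
    constructor
    · rintro (⟨h, h'⟩ | ⟨h, h', -⟩)
      exacts [⟨h'.ne', h⟩, ⟨h', h⟩]
    · rintro ⟨h, h'⟩
      tauto
  have h2 : Disjoint (nbrs G S v) (nonnbrs G S v) := by
    rw [Finset.disjoint_left]
    intro w hw hw'
    exact (mem_nonnbrs.1 hw').2.2 (mem_nbrs.1 hw).2
  rw [← Finset.card_union_of_disjoint h2, h1, Finset.card_erase_add_one hv]

/-- A graph on `n` vertices in which all cliques have at most `a` vertices has at most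
`3 ^ ((n + a) / 3)` cliques. -/
theorem cliqueCount_le_pow {c : ℝ} (hc : 0 < c) (hc3 : c ^ 3 = 3) (n : ℕ) :
    ∀ (S : Finset V) (a : ℕ), S.card = n → (∀ s ⊆ S, G.IsClique (s : Set V) → s.card ≤ a) →
      (cliqueCount G S : ℝ) ≤ c ^ (n + a) := by
  classical
  have hc43 : 4 / 3 ≤ c := by
    by_contra! h
    have : c ^ 3 ≤ (4 / 3) ^ 3 := pow_le_pow_left₀ hc.le h.le 3
    norm_num [hc3] at this
  have hc1 : 1 ≤ c := by linarith
  have hc2 : 2 ≤ c ^ 2 := by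
    by_contra! h
    have : (c ^ 2) ^ 3 < 2 ^ 3 := pow_lt_pow_left₀ h (by positivity) (by norm_num)
    rw [← pow_mul, mul_comm, pow_mul, hc3] at this
    norm_num at this
  induction n using Nat.strong_induction_on with
  | _ n ih =>
  intro S a hS ha
  rcases S.eq_empty_or_nonempty with rfl | ⟨v, hv⟩
  · rw [cliqueCount_empty, Nat.cast_one]
    exact one_le_pow₀ hc1
  have hlink : ∀ v ∈ S, ∀ s ⊆ nbrs G S v, G.IsClique (s : Set V) → s.card + 1 ≤ a := by
    intro v hv s hs hcl
    have hvs : v ∉ s := fun h => (mem_nbrs.1 (hs h)).2.ne rfl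
    rw [← Finset.card_insert_of_notMem hvs]
    refine ha _ (Finset.insert_subset hv (hs.trans (nbrs_subset S v))) ?_
    rw [Finset.coe_insert]
    exact hcl.insert fun w hw _ => (mem_nbrs.1 (hs hw)).2
  have ha1 : ∀ v ∈ S, 1 ≤ a := fun v hv => by
    simpa using hlink v hv ∅ (Finset.empty_subset _) (by simp)
  have hn1 : 1 ≤ n := hS ▸ Finset.card_pos.2 ⟨v, hv⟩
  -- Deleting `v` lowers `n` by 1; passing to its neighbours lowers `n` by at least 3 and `a` by 1.
  -- The recursion closes since `c ^ 3 + 1 = 4 ≤ 3 * c = c ^ 4`.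
  by_cases h : ∃ v ∈ S, 2 ≤ (nonnbrs G S v).card
  · obtain ⟨v, hv, h2⟩ := h
    have hcard := card_nbrs_add_card_nonnbrs (G := G) hv
    have ha' := ha1 v hv
    obtain ⟨a, rfl⟩ : ∃ b, a = b + 1 := ⟨a - 1, by omega⟩
    obtain ⟨m, rfl⟩ : ∃ m, n = m + 3 := ⟨n - 3, by omega⟩
    have h1 := ih (m + 2) (by omega) (S.erase v) (a + 1)
      (by rw [Finset.card_erase_of_mem hv, hS]; rfl)
      (fun s hs => ha s (hs.trans (Finset.erase_subset _ _)))
    have h2 := ih _ (by omega) (nbrs G S v) a rfl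
      fun s hs hcl => Nat.succ_le_succ_iff.1 (hlink v hv s hs hcl)
    have h3 : c ^ ((nbrs G S v).card + a) ≤ c ^ (m + a) :=
      pow_le_pow_right₀ hc1 (by omega)
    have h4 : (cliqueCount G S : ℝ) ≤ cliqueCount G (S.erase v) + cliqueCount G (nbrs G S v) :=
      mod_cast cliqueCount_le
    calc (cliqueCount G S : ℝ) ≤ c ^ (m + 2 + (a + 1)) + c ^ (m + a) := by linarith
      _ = c ^ (m + a) * (c ^ 3 + 1) := by ring
      _ ≤ c ^ (m + a) * (c ^ 3 * c) := by
        refine mul_le_mul_of_nonneg_left ?_ (by positivity)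
        rw [hc3]; linarith
      _ = c ^ (m + 3 + (a + 1)) := by ring
  -- Now the non-edges form a matching. A vertex adjacent to all others costs a factor `2 ≤ c ^ 2`,
  -- a non-adjacent pair a factor `3 = c ^ 3`, which match the drop of `n + a` by 2 and 3.
  · push Not at h
    have ha' := ha1 v hv
    obtain ⟨a, rfl⟩ : ∃ b, a = b + 1 := ⟨a - 1, by omega⟩
    have hcard := card_nbrs_add_card_nonnbrs (G := G) hv
    have hN : (cliqueCount G (nbrs G S v) : ℝ) ≤ c ^ ((nbrs G S v).card + a) :=
      ih _ (by omega) (nbrs G S v) a rfl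
        fun s hs hcl => Nat.succ_le_succ_iff.1 (hlink v hv s hs hcl)
    have herase : S.erase v = nbrs G S v ∪ nonnbrs G S v := by
      ext w
      simp only [Finset.mem_union, mem_nbrs, mem_nonnbrs, Finset.mem_erase]
      constructor
      · tauto
      · rintro (⟨h, h'⟩ | ⟨h, h', -⟩)
        exacts [⟨h'.ne', h⟩, ⟨h', h⟩]
    have h0 : cliqueCount G S ≤ cliqueCount G (S.erase v) + cliqueCount G (nbrs G S v) :=
      cliqueCount_le
    have hcase : (nonnbrs G S v).card = 0 ∨ (nonnbrs G S v).card = 1 := by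
      have := h v hv; omega
    rcases hcase with h1 | h1
    · rw [Finset.card_eq_zero] at h1
      rw [herase, h1, Finset.union_empty] at h0
      have h0' : (cliqueCount G S : ℝ) ≤ 2 * cliqueCount G (nbrs G S v) := by
        exact_mod_cast h0.trans (by omega)
      rw [h1, Finset.card_empty] at hcard
      calc (cliqueCount G S : ℝ) ≤ 2 * cliqueCount G (nbrs G S v) := h0'
        _ ≤ c ^ 2 * c ^ ((nbrs G S v).card + a) :=
          mul_le_mul hc2 hN (by positivity) (by positivity)
        _ = c ^ (n + (a + 1)) := by rw [← hS, ← hcard]; ring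
    · obtain ⟨w, hw⟩ := Finset.card_eq_one.1 h1
      have h3 : cliqueCount G (S.erase v) ≤ 2 * cliqueCount G (nbrs G S v) := by
        refine (cliqueCount_le (v := w)).trans ?_
        have hsub1 : (S.erase v).erase w ⊆ nbrs G S v := by
          rw [herase, hw]
          intro x hx
          simp only [Finset.mem_erase, Finset.mem_union, Finset.mem_singleton] at hx
          tauto
        have hsub2 : nbrs G (S.erase v) w ⊆ nbrs G S v := by
          intro x hx
          refine hsub1 (Finset.mem_erase.2 ⟨?_, nbrs_subset _ _ hx⟩)
          exact (mem_nbrs.1 hx).2.ne'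
        have := cliqueCount_mono (G := G) hsub1
        have := cliqueCount_mono (G := G) hsub2
        omega
      have h0' : (cliqueCount G S : ℝ) ≤ 3 * cliqueCount G (nbrs G S v) := by
        exact_mod_cast h0.trans (by omega)
      rw [h1] at hcard
      calc (cliqueCount G S : ℝ) ≤ 3 * cliqueCount G (nbrs G S v) := h0'
        _ ≤ c ^ 3 * c ^ ((nbrs G S v).card + a) := by
          rw [hc3]; exact mul_le_mul_of_nonneg_left hN (by norm_num)
        _ = c ^ (n + (a + 1)) := by rw [← hS, ← hcard]; ring

/-- If every nearly complete part of `S` has at most `Q` cliques, then `S` has not many more. -/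
theorem cliqueCount_le_of_nearly_complete {M Q : ℕ} (hM : 1 ≤ M) (j : ℕ) :
    ∀ S : Finset V, (∀ T ⊆ S, (∀ v ∈ T, M * (nonnbrs G T v).card ≤ T.card) → cliqueCount G T ≤ Q) →
      (S.card : ℝ) * (1 - 1 / M) ^ j < 1 → cliqueCount G S ≤ Q * (S.card + 1) ^ j := by
  classical
  have hM0 : (0 : ℝ) < M := by exact_mod_cast hM
  induction j with
  | zero =>
    intro S hS hlt
    have : S = ∅ := by
      rw [pow_zero, mul_one] at hlt
      exact Finset.card_eq_zero.1 (Nat.lt_one_iff.1 (by exact_mod_cast hlt))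
    subst this
    simpa using hS ∅ subset_rfl (by simp)
  | succ j ihj =>
    intro S
    induction S using Finset.strongInduction with
    | _ S ihS =>
    intro hS hlt
    by_cases h : ∀ v ∈ S, M * (nonnbrs G S v).card ≤ S.card
    · refine (hS S subset_rfl h).trans (Nat.le_mul_of_pos_right _ (by positivity))
    push Not at h
    -- Cliques avoiding `v` are counted in a set with one vertex less and the same `j`. Cliques
    -- through `v` live in its neighbourhood, smaller by a factor `1 - 1 / M`, which pays for
    -- lowering `j`.
    obtain ⟨v, hv, hvM⟩ := h
    have hfac : (0 : ℝ) ≤ 1 - 1 / M := by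
      rw [sub_nonneg, div_le_one hM0]
      exact_mod_cast hM
    have h1 := ihS (S.erase v) (Finset.erase_ssubset hv)
      (fun T hT => hS T (hT.trans (Finset.erase_subset _ _))) <| by
        refine lt_of_le_of_lt (mul_le_mul_of_nonneg_right ?_ (by positivity)) hlt
        exact_mod_cast Finset.card_erase_le
    have hcard := card_nbrs_add_card_nonnbrs (G := G) hv
    have h2 := ihj (nbrs G S v) (fun T hT => hS T (hT.trans (nbrs_subset S v))) <| by
      refine lt_of_le_of_lt ?_ hlt
      rw [pow_succ', ← mul_assoc]
      refine mul_le_mul_of_nonneg_right ?_ (by positivity)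
      have e1 : ((nbrs G S v).card : ℝ) ≤ S.card - (nonnbrs G S v).card := by
        rw [le_sub_iff_add_le]; exact_mod_cast (by omega)
      have e2 : (S.card : ℝ) / M ≤ (nonnbrs G S v).card := by
        rw [div_le_iff₀ hM0, mul_comm]; exact_mod_cast hvM.le
      calc ((nbrs G S v).card : ℝ) ≤ S.card - S.card / M := by linarith
        _ = _ := by ring
    rw [Finset.card_erase_add_one hv] at h1
    have h3 : Q * ((nbrs G S v).card + 1) ^ j ≤ Q * S.card ^ j :=
      Nat.mul_le_mul_left _ (Nat.pow_le_pow_left (by omega) _)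
    calc cliqueCount G S ≤ Q * S.card ^ (j + 1) + Q * S.card ^ j :=
          cliqueCount_le.trans (add_le_add h1 (h2.trans h3))
      _ = Q * (S.card ^ j * (S.card + 1)) := by ring
      _ ≤ Q * ((S.card + 1) ^ j * (S.card + 1)) := by gcongr; omega
      _ = Q * (S.card + 1) ^ (j + 1) := by ring

end CliqueCounts

/-! ### Complete minors in nearly complete graphs -/

section DenseMinors

variable {V : Type*} {G : SimpleGraph V}

-- Double counting: at most `d * d` pairs (v, w) have `w` a common non-neighbour of `u` and `v`, and
-- they are spread over at least `Z.card - 1 - d` neighbours `v` of `u`.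
open Classical in
theorem exists_adj_card_common_nonnbrs_le {T Z : Finset V} (hZ : Z ⊆ T) {d c : ℕ}
    (hd : ∀ v ∈ T, (nonnbrs G T v).card ≤ d) {u : V} (hu : u ∈ Z)
    (hcard : d * d + (1 + d) * (c + 1) < Z.card * (c + 1)) :
    ∃ v ∈ Z, G.Adj u v ∧ (nonnbrs G T u ∩ nonnbrs G T v).card ≤ c := by
  by_contra! hcon
  set Y := nbrs G Z u with hY
  have hYcard : Z.card ≤ Y.card + d + 1 := by
    have hsplit := card_nbrs_add_card_nonnbrs (G := G) hu
    have : nonnbrs G Z u ⊆ nonnbrs G T u := fun w hw => by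
      rw [mem_nonnbrs] at hw ⊢
      exact ⟨hZ hw.1, hw.2⟩
    have := (Finset.card_le_card this).trans (hd u (hZ hu))
    rw [hY]
    omega
  have hlow : Y.card * (c + 1) ≤ ∑ v ∈ Y, (nonnbrs G T u ∩ nonnbrs G T v).card := by
    rw [← smul_eq_mul]
    exact Finset.card_nsmul_le_sum _ _ _ fun v hv => hcon v (mem_nbrs.1 hv).1 (mem_nbrs.1 hv).2
  have hswap : ∑ v ∈ Y, (nonnbrs G T u ∩ nonnbrs G T v).card =
      ∑ w ∈ nonnbrs G T u, (Y.filter fun v => w ∈ nonnbrs G T v).card := by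
    change _ = ∑ w ∈ nonnbrs G T u, (Finset.bipartiteBelow (fun v w => w ∈ nonnbrs G T v) Y w).card
    rw [← Finset.sum_card_bipartiteAbove_eq_sum_card_bipartiteBelow
      (r := fun v w => w ∈ nonnbrs G T v)]
    refine Finset.sum_congr rfl fun v _ => ?_
    simp only [Finset.bipartiteAbove, Finset.filter_mem_eq_inter]
  have hup : ∑ w ∈ nonnbrs G T u, (Y.filter fun v => w ∈ nonnbrs G T v).card ≤ d * d := by
    refine (Finset.sum_le_card_nsmul _ _ d fun w hw => ?_).trans ?_
    · refine (Finset.card_le_card fun v hv => ?_).trans (hd w (mem_nonnbrs.1 hw).1)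
      obtain ⟨hv, hwv⟩ := Finset.mem_filter.1 hv
      rw [mem_nonnbrs] at hwv ⊢
      exact ⟨hZ (mem_nbrs.1 hv).1, hwv.2.1.symm, fun h => hwv.2.2 h.symm⟩
    · rw [smul_eq_mul]
      exact Nat.mul_le_mul_right _ (hd u (hZ hu))
  have : Z.card * (c + 1) ≤ (Y.card + d + 1) * (c + 1) := Nat.mul_le_mul_right _ hYcard
  nlinarith

open Classical in
/-- A clique can be extended to a complete minor by greedily chosen adjacent pairs with few common
non-neighbours. -/
theorem exists_isCliqueModel_of_pairs [Finite V] {T I : Finset V}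
    (hI : G.IsClique (I : Set V)) {c k : ℕ}
    (h : ∀ Y ⊆ T, Y.card + (c + 2) ≤ k * (c + 2) → ∃ u ∈ T \ (I ∪ Y), ∃ v ∈ T \ (I ∪ Y),
      G.Adj u v ∧ (nonnbrs G T u ∩ nonnbrs G T v).card ≤ c ∧
        ∀ w ∈ I, G.Adj w u ∨ G.Adj w v) :
    ∃ P : Set (Set V), IsCliqueModel G P ∧ P.ncard = I.card + k := by
  -- `Y` collects the chosen pairs and their common non-neighbours, at most `c + 2` vertices per
  -- pair. Every vertex of `T` outside `Y` is then adjacent to each chosen pair, so later pairs fit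
  -- automatically.
  suffices H : ∃ P : Set (Set V), ∃ Y ⊆ T, IsCliqueModel G P ∧ P.ncard = I.card + k ∧
      Y.card ≤ k * (c + 2) ∧ ∀ B ∈ P, (∃ a ∈ I, B = {a}) ∨
        (B ⊆ Y ∧ ∀ w ∈ T \ Y, ∃ b ∈ B, G.Adj w b) by
    obtain ⟨P, -, -, hP, hcard, -⟩ := H
    exact ⟨P, hP, hcard⟩
  induction k with
  | zero =>
    refine ⟨(fun a => {a}) '' (I : Set V), ∅, by simp, ⟨?_, ?_⟩, ?_, by simp, ?_⟩
    · rintro _ ⟨a, -, rfl⟩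
      exact connected_induce_singleton G a
    · rintro _ ⟨a, ha, rfl⟩ _ ⟨b, hb, rfl⟩ hab
      have hne : a ≠ b := fun h => hab (h ▸ rfl)
      exact ⟨by simpa using hne, a, rfl, b, rfl, hI ha hb hne⟩
    · rw [(Set.singleton_injective.injOn).ncard_image, Set.ncard_coe_finset, add_zero]
    · rintro _ ⟨a, ha, rfl⟩
      exact Or.inl ⟨a, ha, rfl⟩
  | succ k ih =>
    obtain ⟨P, Y, hYT, hP, hPcard, hYcard, hPY⟩ := ih fun Y hY hYc =>
      h Y hY (hYc.trans (Nat.mul_le_mul_right _ (Nat.le_succ k)))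
    obtain ⟨u, hu, v, hv, huv, hc, hwI⟩ := h Y hYT (by rw [Nat.succ_mul]; omega)
    simp only [Finset.mem_sdiff, Finset.mem_union, not_or] at hu hv
    have hnew : ∀ C ∈ P, Disjoint ({u, v} : Set V) C ∧
        ∃ a ∈ ({u, v} : Set V), ∃ b ∈ C, G.Adj a b := by
      intro C hC
      rcases hPY C hC with ⟨a, ha, rfl⟩ | ⟨hCY, hCT⟩
      · refine ⟨?_, ?_⟩
        · rw [Set.disjoint_singleton_right]
          rintro (rfl | rfl)
          exacts [hu.2.1 ha, hv.2.1 ha]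
        · rcases hwI a ha with h | h
          exacts [⟨u, by simp, a, rfl, h.symm⟩, ⟨v, by simp, a, rfl, h.symm⟩]
      · refine ⟨?_, ?_⟩
        · rw [Set.disjoint_left]
          rintro _ (rfl | rfl) hC'
          exacts [hu.2.2 (hCY hC'), hv.2.2 (hCY hC')]
        · obtain ⟨b, hb, hub⟩ := hCT u (by simp [hu])
          exact ⟨u, by simp, b, hb, hub⟩
    have hnot : ({u, v} : Set V) ∉ P := fun hmem => by
      have := (hnew _ hmem).1
      rw [Set.disjoint_left] at this
      exact this (Or.inl rfl) (Or.inl rfl)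
    refine ⟨insert {u, v} P, Y ∪ ({u, v} ∪ (nonnbrs G T u ∩ nonnbrs G T v)), ?_,
      hP.insert (induce_pair_connected_of_adj huv) hnew, ?_, ?_, ?_⟩
    · refine Finset.union_subset hYT (Finset.union_subset ?_ fun w hw => ?_)
      · simp [Finset.insert_subset_iff, hu, hv]
      · exact (mem_nonnbrs.1 (Finset.mem_inter.1 hw).1).1
    · rw [Set.ncard_insert_of_notMem hnot (Set.toFinite _), hPcard, add_assoc]
    · have h1 := Finset.card_union_le Y ({u, v} ∪ (nonnbrs G T u ∩ nonnbrs G T v))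
      have h2 := Finset.card_union_le {u, v} (nonnbrs G T u ∩ nonnbrs G T v)
      have h3 := Finset.card_le_two (a := u) (b := v)
      rw [Nat.succ_mul]
      omega
    · rintro B (rfl | hB)
      · refine Or.inr ⟨?_, fun w hw => ?_⟩
        · rintro _ (rfl | rfl) <;> simp
        · simp only [Finset.mem_sdiff, Finset.mem_union, Finset.mem_inter, mem_nonnbrs,
            Finset.mem_insert, Finset.mem_singleton, not_or, not_and] at hw
          by_contra! hcon
          have h1 : ¬ G.Adj u w := fun h => hcon u (by simp) h.symm
          have h2 : ¬ G.Adj v w := fun h => hcon v (by simp) h.symm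
          exact hw.2.2.2 ⟨hw.1, hw.2.2.1.1, h1⟩ hw.1 hw.2.2.1.2 h2
      · rcases hPY B hB with h | ⟨h1, h2⟩
        · exact Or.inl h
        · refine Or.inr ⟨h1.trans (Finset.coe_subset.2 Finset.subset_union_left), fun w hw => h2 w ?_⟩
          simp only [Finset.mem_sdiff, Finset.mem_union, not_or] at hw ⊢
          exact ⟨hw.1, hw.2.1⟩

-- Otherwise `t` pairs could be chosen greedily. With `c` about `4 * N / M ^ 2`, the pairs use at
-- most `t * (c + 2) ≤ N / 2` vertices, since `16 * t ≤ M ^ 2` and `8 * t ≤ N`. Half of `T` stays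
-- available, enough for the double counting.
open Classical in
theorem CompleteMinorFree.card_lt_of_nearly_complete [Finite V] {t : ℕ}
    (hG : CompleteMinorFree t G) {M : ℕ} (hM : 8 ≤ M) (hMt : 16 * t ≤ M ^ 2) {T : Finset V}
    (hT : ∀ v ∈ T, M * (nonnbrs G T v).card ≤ T.card) : T.card < 8 * t := by
  by_contra! hcard
  have hM2 : 0 < M ^ 2 := by positivity
  set N := T.card with hN
  set c := 4 * N / M ^ 2 with hc
  set d := N / M with hd
  have hdT : ∀ v ∈ T, (nonnbrs G T v).card ≤ d := fun v hv => by
    rw [hd, Nat.le_div_iff_mul_le (by omega), mul_comm]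
    exact hT v hv
  have hdM : d * M ≤ N := Nat.div_mul_le_self _ _
  have hcM : c * M ^ 2 ≤ 4 * N := Nat.div_mul_le_self _ _
  have hcM' : 4 * N < (c + 1) * M ^ 2 := by
    rw [mul_comm (c + 1)]
    exact Nat.lt_mul_div_succ (4 * N) hM2
  have hct : 4 * (t * c) ≤ N := by
    have : 16 * t * c ≤ c * M ^ 2 := by rw [mul_comm c]; exact Nat.mul_le_mul_right _ hMt
    nlinarith
  have h8d : 8 * d ≤ N := le_trans (by rw [mul_comm]; exact Nat.mul_le_mul_left _ hM) hdM
  have hdd : 4 * (d * d) ≤ N * (c + 1) := by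
    have h1 : (d * M) * (d * M) ≤ N * N := Nat.mul_le_mul hdM hdM
    have h2 : 4 * (d * d) * M ^ 2 ≤ N * (c + 1) * M ^ 2 := by nlinarith
    exact Nat.le_of_mul_le_mul_right h2 hM2
  clear_value c d
  obtain ⟨P, hP, hPcard⟩ := exists_isCliqueModel_of_pairs (G := G) (T := T) (I := ∅) (c := c)
    (k := t) (by simp) <| by
      intro Y hY hYcard
      simp only [Finset.empty_union, Finset.notMem_empty, false_imp_iff, implies_true, and_true]
      have hZ : N ≤ (T \ Y).card + Y.card := by
        rw [Finset.card_sdiff_add_card_eq_card hY]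
      have hZ2 : N + 4 ≤ 2 * (T \ Y).card := by
        rw [mul_add] at hYcard
        omega
      have hZ3 := Nat.mul_le_mul_right (c + 1) hZ2
      have h8d' := Nat.mul_le_mul_right (c + 1) h8d
      obtain ⟨u, hu⟩ : (T \ Y).Nonempty := Finset.card_pos.1 (by omega)
      obtain ⟨v, hv, huv, hcv⟩ := exists_adj_card_common_nonnbrs_le (G := G) (c := c)
        (Finset.sdiff_subset (s := T) (t := Y)) hdT hu (by nlinarith)
      exact ⟨u, hu, v, hv, huv, hcv⟩
  have := hG.ncard_lt hP
  simp at hPcard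
  omega

-- With `c = 0`, the pairs have no common non-neighbours, so each costs only two vertices and is
-- adjacent to everything else in `T`, including the clique `I` kept as singletons. Pairs are found
-- while more than `q ^ 2 + q + 1` vertices remain, which yields about `I.card + (T.card - I.card) /
-- 2` branch sets.
open Classical in
theorem CompleteMinorFree.card_add_card_le [Finite V] {t : ℕ} (hG : CompleteMinorFree t G)
    {q : ℕ} {T I : Finset V} (hT : ∀ v ∈ T, (nonnbrs G T v).card ≤ q) (hIT : I ⊆ T)
    (hI : G.IsClique (I : Set V)) : T.card + I.card ≤ 2 * t + q ^ 2 + q := by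
  obtain ⟨P, hP, hPcard⟩ := exists_isCliqueModel_of_pairs (G := G) (T := T) (c := 0)
    (k := (T.card - I.card - (q ^ 2 + q)) / 2) hI <| by
      intro Y hY hYcard
      have hZ : T.card ≤ (T \ (I ∪ Y)).card + (I.card + Y.card) := by
        have h1 := Finset.card_le_card_sdiff_add_card (s := T) (t := I ∪ Y)
        have h2 := Finset.card_union_le I Y
        omega
      have hZ2 : q * q + (1 + q) + 1 ≤ (T \ (I ∪ Y)).card := by
        rw [← pow_two]; omega
      obtain ⟨u, hu⟩ : (T \ (I ∪ Y)).Nonempty := Finset.card_pos.1 (by omega)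
      obtain ⟨v, hv, huv, hcv⟩ := exists_adj_card_common_nonnbrs_le (G := G) (c := 0)
        (Finset.sdiff_subset (s := T) (t := I ∪ Y)) hT hu (by omega)
      refine ⟨u, hu, v, hv, huv, hcv, fun w hw => ?_⟩
      by_contra! hcon
      have hne : ∀ x ∈ T \ (I ∪ Y), w ≠ x := by
        rintro x hx rfl
        simp [hw] at hx
      have : w ∈ nonnbrs G T u ∩ nonnbrs G T v := by
        simp only [Finset.mem_inter, mem_nonnbrs]
        exact ⟨⟨hIT hw, hne u hu, fun h => hcon.1 h.symm⟩,
          ⟨hIT hw, hne v hv, fun h => hcon.2 h.symm⟩⟩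
      rw [Nat.le_zero, Finset.card_eq_zero] at hcv
      rw [hcv] at this
      exact absurd this (Finset.notMem_empty w)
  have := hG.ncard_lt hP
  omega

end DenseMinors

/-! ### Cliques of minor-free graphs -/

section CliquesOfMinorFreeGraphs

variable {V : Type*} {G : SimpleGraph V}

/-- The crude bound `T.card < 8 * t ≤ 8 * q ^ 4` turns the relative bound on non-neighbours into the
absolute bound `q`, for which the sharp estimate of `T.card + I.card` applies. -/
theorem CompleteMinorFree.cliqueCount_le_of_nearly_complete [Finite V] {t : ℕ}
    (hG : CompleteMinorFree t G) {q : ℕ} (hq : 1 ≤ q) (htq : t ≤ q ^ 4) {c : ℝ} (hc : 0 < c)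
    (hc3 : c ^ 3 = 3) {T : Finset V}
    (hT : ∀ v ∈ T, 8 * q ^ 3 * (nonnbrs G T v).card ≤ T.card) :
    (cliqueCount G T : ℝ) ≤ c ^ (2 * t + q ^ 2 + q) := by
  have hq3 : 1 ≤ q ^ 3 := Nat.one_le_pow _ _ hq
  have hM : 16 * t ≤ (8 * q ^ 3) ^ 2 := by
    have : q ^ 4 ≤ q ^ 6 := Nat.pow_le_pow_right hq (by norm_num)
    calc 16 * t ≤ 64 * q ^ 6 := by omega
      _ = _ := by ring
  have hcard := hG.card_lt_of_nearly_complete (M := 8 * q ^ 3) (by omega) hM hT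
  have hnon : ∀ v ∈ T, (nonnbrs G T v).card ≤ q := by
    intro v hv
    by_contra! h
    have h1 := hT v hv
    have h2 : 8 * q ^ 3 * q ≤ 8 * q ^ 3 * (nonnbrs G T v).card := Nat.mul_le_mul_left _ h.le
    have h3 : 8 * q ^ 3 * q = 8 * q ^ 4 := by ring
    omega
  have hTle := hG.card_add_card_le hnon (Finset.empty_subset T) (by simp)
  rw [Finset.card_empty, add_zero] at hTle
  refine (cliqueCount_le_pow hc hc3 _ T (2 * t + q ^ 2 + q - T.card) rfl fun s hs hcl => ?_).trans
    (le_of_eq ?_)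
  · have := hG.card_add_card_le hnon hs hcl
    omega
  · congr 1
    omega

/-- With `M = 8 * q ^ 3`, passing `M * l` times to a neighbourhood shrinks the set by a factor `exp
(-l)`, hence to nothing. -/
theorem CompleteMinorFree.cliqueCount_le_of_card_le [Finite V] {t : ℕ}
    (hG : CompleteMinorFree t G) {q : ℕ} (hq : 1 ≤ q) (htq : t ≤ q ^ 4) {c : ℝ} (hc : 0 < c)
    (hc3 : c ^ 3 = 3) {d l : ℕ} (hl : (d + 1 : ℝ) ≤ Real.exp l) {S : Finset V}
    (hS : S.card ≤ d) :
    (cliqueCount G S : ℝ) ≤ c ^ (2 * t + q ^ 2 + q) * Real.exp l ^ (8 * q ^ 3 * l) := by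
  have hM : 1 ≤ 8 * q ^ 3 := by
    have : 1 ≤ q ^ 3 := Nat.one_le_pow _ _ hq
    omega
  have hSd : (S.card : ℝ) ≤ d := by exact_mod_cast hS
  have hsmall : (S.card : ℝ) * (1 - 1 / (8 * q ^ 3 : ℕ)) ^ (8 * q ^ 3 * l) < 1 := by
    generalize 8 * q ^ 3 = M at hM
    have hM0 : (0 : ℝ) < M := by exact_mod_cast hM
    have h0 : (0 : ℝ) ≤ 1 - 1 / M := by
      rw [sub_nonneg, div_le_one hM0]; exact_mod_cast hM
    have h1 : (1 - 1 / M : ℝ) ^ (M * l) ≤ Real.exp (-l) := by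
      calc (1 - 1 / M : ℝ) ^ (M * l) ≤ Real.exp (-(1 / M)) ^ (M * l) :=
            pow_le_pow_left₀ h0 (Real.one_sub_le_exp_neg _) _
        _ = Real.exp (-l) := by
            rw [← Real.exp_nat_mul]; congr 1; push_cast; field_simp
    calc (S.card : ℝ) * (1 - 1 / M) ^ (M * l) ≤ S.card * Real.exp (-l) :=
          mul_le_mul_of_nonneg_left h1 (by positivity)
      _ < Real.exp l * Real.exp (-l) := by
          refine mul_lt_mul_of_pos_right ?_ (Real.exp_pos _)
          linarith
      _ = 1 := by rw [← Real.exp_add]; simp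
  have h := FlipWidthGame.cliqueCount_le_of_nearly_complete (G := G)
    (Q := ⌊c ^ (2 * t + q ^ 2 + q)⌋₊) hM (8 * q ^ 3 * l) S
    (fun T _ hT => Nat.le_floor (hG.cliqueCount_le_of_nearly_complete hq htq hc hc3 hT)) hsmall
  calc (cliqueCount G S : ℝ)
      ≤ (⌊c ^ (2 * t + q ^ 2 + q)⌋₊ * (S.card + 1) ^ (8 * q ^ 3 * l) : ℕ) := by exact_mod_cast h
    _ = (⌊c ^ (2 * t + q ^ 2 + q)⌋₊ : ℝ) * (S.card + 1) ^ (8 * q ^ 3 * l) := by push_cast; rfl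
    _ ≤ _ := by
      refine mul_le_mul (Nat.floor_le (by positivity)) ?_ (by positivity) (by positivity)
      exact pow_le_pow_left₀ (by positivity) (by linarith) _

/-- Deleting a vertex of degree at most `3 * t ^ 2` loses at most `X` cliques. -/
theorem CompleteMinorFree.cliqueCount_le_card_mul [Finite V] {t : ℕ}
    (hG : CompleteMinorFree t G) {X : ℝ}
    (hX : ∀ S : Finset V, S.card ≤ 3 * t ^ 2 → (cliqueCount G S : ℝ) ≤ X) (S : Finset V) :
    (cliqueCount G S : ℝ) ≤ 1 + S.card * X := by
  classical
  induction S using Finset.strongInduction with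
  | _ S ih =>
    rcases S.eq_empty_or_nonempty with rfl | hS
    · simp [cliqueCount_empty]
    have : Nonempty (S : Set V) := hS.to_subtype
    obtain ⟨v, hv⟩ :=
      (hG.of_isMinor (isMinor_induce G (S : Set V))).exists_ncard_neighborSet_le
    have hvS : v.1 ∈ S := v.2
    have hnb : (nbrs G S v).card ≤ 3 * t ^ 2 := by
      refine le_trans ?_ hv
      rw [← Set.ncard_coe_finset, ← Set.ncard_image_of_injective _ Subtype.val_injective]
      refine Set.ncard_le_ncard fun w hw => ?_
      obtain ⟨hwS, hvw⟩ := mem_nbrs.1 hw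
      exact ⟨⟨w, hwS⟩, hvw, rfl⟩
    have h1 := ih (S.erase v) (Finset.erase_ssubset hvS)
    have h2 := hX _ hnb
    have h3 : (cliqueCount G S : ℝ) ≤ cliqueCount G (S.erase v) + cliqueCount G (nbrs G S v) :=
      mod_cast cliqueCount_le
    have h4 : (S.card : ℝ) = (S.erase v).card + 1 := by
      rw [← Finset.card_erase_add_one hvS]; push_cast; rfl
    rw [h4]
    linarith

theorem ncard_isClique_eq_cliqueCount [Fintype V] :
    {s : Set V | G.IsClique s}.ncard = cliqueCount G Finset.univ := by
  classical
  rw [cliqueCount, ← Set.ncard_coe_finset,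
    ← Set.ncard_image_of_injective _ (Finset.coe_injective (α := V))]
  congr 1
  ext s
  simp only [Set.mem_ofPred_eq, Set.mem_image, Finset.mem_coe, Finset.mem_filter]
  constructor
  · intro hs
    exact ⟨s.toFinset, by simpa using hs, by simp⟩
  · rintro ⟨u, hu, rfl⟩
    exact hu.2

end CliquesOfMinorFreeGraphs

/-! ### The final bound and its error term -/

section Bound

/-- With `A.ncard ≤ 7 * t ^ 2 * r`, the parts number at most `A.ncard + 2 * (1 + A.ncard * X) ≤ 23 *
t ^ 2 * r * X`. The constant is rounded up to `27 = 3 ^ 3`, which moves into the exponent as the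
summand 3 of `errorTerm`. -/
theorem CompleteMinorFree.flipWidth_le {V : Type*} [Finite V] {G : SimpleGraph V} {t r : ℕ}
    (hG : CompleteMinorFree t G) (ht : 1 ≤ t) (hr : 1 ≤ r) {q : ℕ} (hq : 1 ≤ q)
    (htq : t ≤ q ^ 4) {c : ℝ} (hc : 1 ≤ c) (hc3 : c ^ 3 = 3) {l : ℕ}
    (hl : (3 * t ^ 2 + 1 : ℝ) ≤ Real.exp l) :
    (flipWidth G r : ℝ) ≤
      27 * t ^ 2 * r * (c ^ (2 * t + q ^ 2 + q) * Real.exp l ^ (8 * q ^ 3 * l)) := by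
  set X : ℝ := c ^ (2 * t + q ^ 2 + q) * Real.exp l ^ (8 * q ^ 3 * l) with hX
  have hX1 : 1 ≤ X := by
    refine one_le_mul_of_one_le_of_one_le (one_le_pow₀ hc) (one_le_pow₀ ?_)
    exact Real.one_le_exp (by positivity)
  have ht' : (1 : ℝ) ≤ t := by exact_mod_cast ht
  have hr' : (1 : ℝ) ≤ r := by exact_mod_cast hr
  have htr : (1 : ℝ) ≤ t ^ 2 * r := one_le_mul_of_one_le_of_one_le (one_le_pow₀ ht') hr'
  have htrX : 1 ≤ t ^ 2 * r * X := one_le_mul_of_one_le_of_one_le htr hX1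
  have hpos : 0 ≤ 27 * t ^ 2 * r * X := by nlinarith
  refine le_trans ?_ (Nat.floor_le hpos)
  norm_cast
  refine Nat.sInf_le ⟨Nat.le_floor (by push_cast; linarith), hG.flipperWins fun A hA => ?_⟩
  refine isKFlip_isolate G A (Nat.le_floor ?_)
  obtain ⟨K, hKG, hK⟩ := exists_isMinor_ncard_traces_le G A
  have hKfree := hG.of_isMinor hKG
  have := Fintype.ofFinite A
  have hcl := hKfree.cliqueCount_le_card_mul (X := X) (fun S hS =>
    hKfree.cliqueCount_le_of_card_le hq htq (by linarith) hc3 (d := 3 * t ^ 2)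
      (by exact_mod_cast hl) hS) Finset.univ
  rw [ncard_isClique_eq_cliqueCount] at hK
  rw [Finset.card_univ, ← Nat.card_eq_fintype_card, Nat.card_coe_set_eq] at hcl
  have hK' : ((traces G A).ncard : ℝ) ≤ 2 * cliqueCount K Finset.univ := by exact_mod_cast hK
  have hA' : (A.ncard : ℝ) ≤ t ^ 2 * (4 * r + 3) := by exact_mod_cast hA
  have hA7 : (A.ncard : ℝ) ≤ 7 * (t ^ 2 * r) := by nlinarith [sq_nonneg (t : ℝ)]
  have hAX : (A.ncard : ℝ) * X ≤ 7 * (t ^ 2 * r) * X :=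
    mul_le_mul_of_nonneg_right hA7 (by linarith)
  have hAX' : (A.ncard : ℝ) ≤ A.ncard * X := le_mul_of_one_le_right (by positivity) hX1
  push_cast
  linarith

/-- The lower order term in the exponent. -/
noncomputable def errorTerm (t : ℕ) : ℝ :=
  3 + ((⌈(t : ℝ) ^ (1 / 4 : ℝ)⌉₊ : ℝ) ^ 2 + ⌈(t : ℝ) ^ (1 / 4 : ℝ)⌉₊) / 3 +
    8 * (⌈(t : ℝ) ^ (1 / 4 : ℝ)⌉₊ : ℝ) ^ 3 * (⌈Real.log (3 * t ^ 2 + 1)⌉₊ : ℝ) ^ 2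

theorem CompleteMinorFree.flipWidth_le_errorTerm {V : Type*} [Finite V] {G : SimpleGraph V}
    {t r : ℕ} (hG : CompleteMinorFree t G) (ht : 1 ≤ t) (hr : 1 ≤ r) :
    (flipWidth G r : ℝ) ≤ (3 : ℝ) ^ (2 * (t : ℝ) / 3 + errorTerm t) * (t : ℝ) ^ 2 * (r : ℝ) := by
  unfold errorTerm
  set q := ⌈(t : ℝ) ^ (1 / 4 : ℝ)⌉₊ with hq
  set l := ⌈Real.log (3 * t ^ 2 + 1)⌉₊ with hl
  have ht0 : (0 : ℝ) < t := by exact_mod_cast ht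
  have hq1 : 1 ≤ q := Nat.one_le_ceil_iff.2 (Real.rpow_pos_of_pos ht0 _)
  have htq : t ≤ q ^ 4 := by
    have h : (t : ℝ) ^ (1 / 4 : ℝ) ≤ q := Nat.le_ceil _
    have h4 : ((t : ℝ) ^ (1 / 4 : ℝ)) ^ 4 = t := by
      rw [← Real.rpow_natCast, ← Real.rpow_mul ht0.le]; norm_num
    have := pow_le_pow_left₀ (by positivity) h 4
    rw [h4] at this
    exact_mod_cast this
  have hle : (3 * t ^ 2 + 1 : ℝ) ≤ Real.exp l := by
    rw [← Real.log_le_iff_le_exp (by positivity)]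
    exact Nat.le_ceil _
  have hc3 : ((3 : ℝ) ^ (1 / 3 : ℝ)) ^ 3 = 3 := by
    rw [← Real.rpow_natCast, ← Real.rpow_mul (by norm_num)]; norm_num
  refine (hG.flipWidth_le ht hr hq1 htq (Real.one_le_rpow (by norm_num) (by norm_num)) hc3
    hle).trans ?_
  have he : Real.exp l ^ (8 * q ^ 3 * l) ≤ (3 : ℝ) ^ (8 * (q : ℝ) ^ 3 * (l : ℝ) ^ 2) := by
    have h1 : Real.exp l ≤ 3 ^ l := by
      rw [← Real.exp_one_pow]
      exact pow_le_pow_left₀ (Real.exp_pos _).le Real.exp_one_lt_three.le _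
    refine (pow_le_pow_left₀ (Real.exp_pos _).le h1 _).trans (le_of_eq ?_)
    rw [← pow_mul, ← Real.rpow_natCast]
    congr 1
    push_cast
    ring
  have hcpow : ((3 : ℝ) ^ (1 / 3 : ℝ)) ^ (2 * t + q ^ 2 + q) =
      (3 : ℝ) ^ (2 * (t : ℝ) / 3 + ((q : ℝ) ^ 2 + q) / 3) := by
    rw [← Real.rpow_natCast, ← Real.rpow_mul (by norm_num)]
    congr 1
    push_cast
    ring
  have h27 : (3 : ℝ) ^ (3 : ℝ) = 27 := by norm_num
  calc 27 * (t : ℝ) ^ 2 * r * (((3 : ℝ) ^ (1 / 3 : ℝ)) ^ (2 * t + q ^ 2 + q) *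
        Real.exp l ^ (8 * q ^ 3 * l))
      ≤ 27 * (t : ℝ) ^ 2 * r * ((3 : ℝ) ^ (2 * (t : ℝ) / 3 + ((q : ℝ) ^ 2 + q) / 3) *
        (3 : ℝ) ^ (8 * (q : ℝ) ^ 3 * (l : ℝ) ^ 2)) := by rw [hcpow]; gcongr
    _ = ((3 : ℝ) ^ (3 : ℝ) * ((3 : ℝ) ^ (2 * (t : ℝ) / 3 + ((q : ℝ) ^ 2 + q) / 3) *
        (3 : ℝ) ^ (8 * (q : ℝ) ^ 3 * (l : ℝ) ^ 2))) * t ^ 2 * r := by rw [h27]; ring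
    _ = _ := by
      rw [← Real.rpow_add (by norm_num), ← Real.rpow_add (by norm_num)]
      congr 3
      ring

theorem errorTerm_isLittleO : errorTerm =o[Filter.atTop] (fun t : ℕ => (t : ℝ)) := by
  have hbig : errorTerm =O[Filter.atTop] (fun t : ℕ => (t : ℝ) ^ (7 / 8 : ℝ)) := by
    refine IsBigO.of_bound (3 + 2 + 64 * 65 ^ 2) (Filter.eventually_atTop.2 ⟨1, fun t ht => ?_⟩)
    have ht1 : (1 : ℝ) ≤ t := by exact_mod_cast ht
    have ht0 : (0 : ℝ) ≤ t := by linarith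
    -- In terms of `y`, the two ceilings are at most `2 * y ^ 4` and `65 * y`, so the dominant term,
    -- cube times square, is O(y^14) = O(t^(7/8)).
    set y : ℝ := (t : ℝ) ^ (1 / 16 : ℝ) with hy
    have hy1 : 1 ≤ y := Real.one_le_rpow ht1 (by norm_num)
    have h14 : (t : ℝ) ^ (1 / 4 : ℝ) = y ^ 4 := by
      rw [hy, ← Real.rpow_natCast, ← Real.rpow_mul ht0]; norm_num
    have h78 : (t : ℝ) ^ (7 / 8 : ℝ) = y ^ 14 := by
      rw [hy, ← Real.rpow_natCast, ← Real.rpow_mul ht0]; norm_num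
    have hq : (⌈(t : ℝ) ^ (1 / 4 : ℝ)⌉₊ : ℝ) ≤ 2 * y ^ 4 := by
      have := Nat.ceil_lt_add_one (a := (t : ℝ) ^ (1 / 4 : ℝ)) (by positivity)
      rw [h14] at this ⊢
      have : 1 ≤ y ^ 4 := one_le_pow₀ hy1
      linarith
    have hl : (⌈Real.log (3 * t ^ 2 + 1)⌉₊ : ℝ) ≤ 65 * y := by
      have h1 := Nat.ceil_lt_add_one (a := Real.log (3 * t ^ 2 + 1))
        (Real.log_nonneg (by nlinarith))
      have h2 := Real.log_le_rpow_div (x := 3 * t ^ 2 + 1) (ε := 1 / 32) (by positivity)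
        (by norm_num)
      have h3 : (3 * (t : ℝ) ^ 2 + 1) ^ (1 / 32 : ℝ) ≤ 2 * y := by
        calc (3 * (t : ℝ) ^ 2 + 1) ^ (1 / 32 : ℝ) ≤ (2 ^ 2 * (t : ℝ) ^ 2) ^ (1 / 32 : ℝ) :=
              Real.rpow_le_rpow (by positivity) (by nlinarith) (by norm_num)
          _ = 2 ^ (1 / 16 : ℝ) * y := by
              rw [← mul_pow, ← Real.rpow_natCast, ← Real.rpow_mul (by positivity),
                Real.mul_rpow (by norm_num) ht0]
              norm_num [hy]
          _ ≤ 2 * y := by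
              refine mul_le_mul_of_nonneg_right ?_ (by linarith)
              exact Real.rpow_le_self_of_one_le (by norm_num) (by norm_num)
      have h4 : Real.log (3 * t ^ 2 + 1) ≤ 64 * y := by
        refine h2.trans ?_
        rw [div_le_iff₀ (by norm_num)]
        linarith
      linarith
    have hnonneg : 0 ≤ errorTerm t := by unfold errorTerm; positivity
    rw [Real.norm_of_nonneg hnonneg, Real.norm_of_nonneg (by positivity), h78]
    unfold errorTerm
    generalize (⌈(t : ℝ) ^ (1 / 4 : ℝ)⌉₊) = q at hq
    generalize (⌈Real.log (3 * t ^ 2 + 1)⌉₊) = l at hl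
    have e1 : (q : ℝ) ^ 2 ≤ (2 * y ^ 4) ^ 2 := pow_le_pow_left₀ (by positivity) hq 2
    have e2 : (q : ℝ) ^ 3 ≤ (2 * y ^ 4) ^ 3 := pow_le_pow_left₀ (by positivity) hq 3
    have e3 : (l : ℝ) ^ 2 ≤ (65 * y) ^ 2 := pow_le_pow_left₀ (by positivity) hl 2
    have e4 : (q : ℝ) ^ 3 * (l : ℝ) ^ 2 ≤ (2 * y ^ 4) ^ 3 * (65 * y) ^ 2 :=
      mul_le_mul e2 e3 (by positivity) (by positivity)
    have f0 : 1 ≤ y ^ 14 := one_le_pow₀ hy1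
    have f1 : y ^ 4 ≤ y ^ 14 := pow_le_pow_right₀ hy1 (by norm_num)
    have f2 : y ^ 8 ≤ y ^ 14 := pow_le_pow_right₀ hy1 (by norm_num)
    have g1 : (2 * y ^ 4) ^ 2 = 4 * y ^ 8 := by ring
    have g2 : (2 * y ^ 4) ^ 3 * (65 * y) ^ 2 = 8 * 65 ^ 2 * y ^ 14 := by ring
    rw [g1] at e1
    rw [g2] at e4
    linarith
  refine hbig.trans_isLittleO ?_
  have hlim : Filter.Tendsto (fun t : ℕ => (t : ℝ) ^ (-(1 / 8) : ℝ)) Filter.atTop (nhds 0) :=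
    (tendsto_rpow_neg_atTop (by norm_num)).comp tendsto_natCast_atTop_atTop
  refine isLittleO_of_tendsto' (Filter.eventually_atTop.2 ⟨1, fun t ht h0 => ?_⟩)
    (hlim.congr' (Filter.eventually_atTop.2 ⟨1, fun t ht => ?_⟩))
  · have : t = 0 := by exact_mod_cast h0
    omega
  · have ht0 : (0 : ℝ) < t := by exact_mod_cast ht
    rw [eq_div_iff ht0.ne', ← Real.rpow_add_one ht0.ne']
    norm_num

end Bound

end FlipWidthGame

theorem mainTheorem5 :
    ∃ g : ℕ → ℝ, g =o[Filter.atTop] (fun t : ℕ => (t : ℝ)) ∧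
      ∀ (r t : ℕ), 1 ≤ r → 1 ≤ t →
        ∀ (V : Type*) [Finite V] (G : SimpleGraph V), FlipWidthGame.CompleteMinorFree t G →
          (FlipWidthGame.flipWidth G r : ℝ) ≤
            (3 : ℝ) ^ (2 * (t : ℝ) / 3 + g t) * (t : ℝ) ^ 2 * (r : ℝ) :=
  ⟨FlipWidthGame.errorTerm, FlipWidthGame.errorTerm_isLittleO, fun _ _ hr ht _ _ _ hG =>
    hG.flipWidth_le_errorTerm ht hr⟩
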